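/- Let $\mathcal I=\lceil\log_2\binom MF\rceil$. For $\mathbf b\in\{0,1\}^M$, with positions numbered $0,\dots,M-1$, let $\mathsf{bit\text{-}flip}(j,\mathbf b)$ be $\mathbf b$ with its $j$-th bit negated and $\mathsf{sgn\text{-}rank}(j,\mathbf b)=\prod_{n=0}^{j}(-1)^{b_n}$. A fermion data structure on $n$ qubits for the strings of length $M$ and Hamming weight at most $F$ consists of an injective linear map $\mathcal E$ from the span of the Fock states $|\mathbf b\rangle_f$ of these strings to the space of $n$ qubits, sending each Fock state to a computational basis state, and of quantum circuits $F_j,R_j$ on these $n$ qubits (so that all ancillas are counted in $n$) for $0\le j<M$, such that $R_j\mathcal E|\mathbf b\rangle_f=\mathsf{sgn\text{-}rank}(j,\mathbf b)\,\mathcal E|\mathbf b\rangle_f$ always, and $F_j\mathcal E|\mathbf b\rangle_f=\mathcal E|\mathsf{bit\text{-}flip}(j,\mathbf b)\rangle_f$ whenever $\mathsf{bit\text{-}flip}(j,\mathbf b)$ has Hamming weight at most $F$. Circuits are over the universal gate set $\{\mathrm H,\mathrm T,\mathrm{CNOT}\}$, and the gate complexity is the maximal number of gates of a circuit $F_j$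 or $R_j$. Put $L=\lceil\log_2(M+1)\rceil$, $G=\lceil\log_2F\rceil$ (with $G=0$ if $F=0$) and $w=L-G$. For a string $\mathbf b$ of weight $f\le F$ let $i^{(1)}<\dots<i^{(f)}$ be the positions of its ones and $i^{(k)}=\infty:=2^L-1$ for $f<k\le F$. Let $i^{(k)}_l\in\{0,1\}^w$ be the $w$ least significant bits of $i^{(k)}$, and let $r_v$ be the number of $k\in\{1,\dots,F\}$ for which the $G$ most significant bits of $i^{(k)}$ have the value $v$. Let $$\mathcal E^{(3)}(\mathbf b)=i^{(1)}_l\,i^{(2)}_l\cdots i^{(F)}_l\ 1^{r_0}\,0\,1^{r_1}\,0\cdots0\,1^{r_{2^G-1}},$$ a string of $Fw+F+2^G-1$ bits. Theorem. There is an absolute constant $C$ such that for all $0\le F<M$ there is a fermion data structure for the strings of length $M$ and Hamming weight at most $F$ that uses at most $\mathcal I+C\,F$ qubits and has gate complexity at most $C\,F\log_2M$. Moreover, its encoding can be taken to be $\mathcal E|\mathbf b\rangle_f=|\mathcal E^{(3)}(\mathbf b)\rangle|0\cdots0\rangle$, where the trailing zeros are ancilla qubits. -/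

import Mathlib

noncomputable section

namespace FermionEncoding

/-! ### Bit strings: Hamming weight, bit-flip, sign-rank -/

/-- The Hamming weight of a bit string, i.e. the number of ones. -/
def hammingWeight {M : ℕ} (b : Fin M → Bool) : ℕ :=
  (Finset.univ.filter fun j => b j = true).card

/-- `bitFlip j b` is `b` with its `j`-th bit negated. -/
def bitFlip {M : ℕ} (j : Fin M) (b : Fin M → Bool) : Fin M → Bool :=
  Function.update b j (!(b j))

/-- `sgnRank j b = ∏_{n ≤ j} (-1)^{b_n}`: the parity, as a sign, of the bits of `b` up to and
including position `j`. -/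
def sgnRank {M : ℕ} (j : Fin M) (b : Fin M → Bool) : ℤ :=
  ∏ n ∈ Finset.Iic j, (-1) ^ (b n).toNat

/-! ### Quantum states -/

/-- The Hilbert space of `n` qubits, with computational basis indexed by the `n`-bit strings. -/
abbrev QubitSpace (n : ℕ) : Type := EuclideanSpace ℂ (Fin n → Bool)

/-- The computational basis state `|x⟩`. -/
def ket {n : ℕ} (x : Fin n → Bool) : QubitSpace n := EuclideanSpace.single x 1

/-- Occupation strings of `M` modes whose number of ones lies between `lo` and `hi`. -/
abbrev Occupation (M lo hi : ℕ) : Type :=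
  {b : Fin M → Bool // lo ≤ hammingWeight b ∧ hammingWeight b ≤ hi}

/-- The Fock space of `M` modes restricted to occupation numbers between `lo` and `hi`: the
Hilbert space with orthonormal basis the Fock states `|b⟩_f`. -/
abbrev FockSpace (M lo hi : ℕ) : Type := EuclideanSpace ℂ (Occupation M lo hi)

/-- The Fock state `|b⟩_f`. -/
def fockState {M lo hi : ℕ} (b : Occupation M lo hi) : FockSpace M lo hi :=
  EuclideanSpace.single b 1

/-! ### Quantum circuits -/

/-- Gates on `n` qubits, over the universal gate set consisting of the Hadamard gate, the
`T` gate and the controlled-NOT gate (`cnot c t` has control `c` and target `t`). -/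
inductive Gate (n : ℕ) : Type
  | hadamard (i : Fin n) : Gate n
  | tGate (i : Fin n) : Gate n
  | cnot (c t : Fin n) (hct : c ≠ t) : Gate n

/-- The `2^n × 2^n` unitary matrix of a gate; the entry at `(y, x)` is `⟨y| g |x⟩`. -/
def Gate.matrix {n : ℕ} : Gate n → Matrix (Fin n → Bool) (Fin n → Bool) ℂ
  | .hadamard i => fun y x =>
      if ∀ k, k ≠ i → y k = x k then
        (-1) ^ ((x i).toNat * (y i).toNat) / (Real.sqrt 2 : ℂ)
      else 0
  | .tGate i => fun y x =>
      if y = x then (if x i then Complex.exp (Complex.I * Real.pi / 4) else 1) else 0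
  | .cnot c t _ => fun y x =>
      if y = (if x c then Function.update x t (!(x t)) else x) then 1 else 0

/-- A circuit on `n` qubits: a list of gates, the head being applied first.
Its gate count is the length of the list. -/
abbrev Circuit (n : ℕ) : Type := List (Gate n)

/-- The matrix implemented by a circuit. -/
def Circuit.matrix {n : ℕ} : Circuit n → Matrix (Fin n → Bool) (Fin n → Bool) ℂ
  | [] => 1
  | g :: c => Circuit.matrix c * g.matrix

/-- The action of a circuit on the states of `n` qubits. -/
def Circuit.apply {n : ℕ} (c : Circuit n) : QubitSpace n →ₗ[ℂ] QubitSpace n :=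
  Matrix.toEuclideanLin (Circuit.matrix c)

/-! ### Fermion data structures -/

/-- A fermion data structure of size `M` on `n` qubits for the strings of Hamming weight between
`lo` and `hi`: an injective linear map from the restricted Fock space to the space of `n` qubits
that sends Fock states to computational basis states, with circuits on these `n` qubits (so that
every ancilla is counted in `n`) for the `bitFlip` and `sgnRank` queries. The `bitFlip` circuit is
unconstrained on strings whose flipped string leaves the capacity. -/
structure FermionDataStructure (M lo hi n : ℕ) where
  encode : FockSpace M lo hi →ₗ[ℂ] QubitSpace n
  encode_injective : Function.Injective encode
  encode_fockState : ∀ b : Occupation M lo hi, ∃ x : Fin n → Bool, encode (fockState b) = ket x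
  flipCircuit : Fin M → Circuit n
  rankCircuit : Fin M → Circuit n
  flip_spec : ∀ (j : Fin M) (b : Occupation M lo hi)
    (h : lo ≤ hammingWeight (bitFlip j b.1) ∧ hammingWeight (bitFlip j b.1) ≤ hi),
    Circuit.apply (flipCircuit j) (encode (fockState b)) = encode (fockState ⟨bitFlip j b.1, h⟩)
  rank_spec : ∀ (j : Fin M) (b : Occupation M lo hi),
    Circuit.apply (rankCircuit j) (encode (fockState b)) =
      (sgnRank j b.1 : ℂ) • encode (fockState b)

/-- The gate complexity: the largest gate count of the query circuits over all positions. -/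
def FermionDataStructure.gateComplexity {M lo hi n : ℕ}
    (D : FermionDataStructure M lo hi n) : ℕ :=
  Finset.univ.sup fun j : Fin M => max (D.flipCircuit j).length (D.rankCircuit j).length

/-- The information-theoretic number of qubits `⌈log₂ (M choose F)⌉`. -/
def infoBound (M F : ℕ) : ℕ := Nat.clog 2 (M.choose F)

end FermionEncoding

end

/-! ### The succinct encoding: least significant bits and stars and bars -/

namespace FermionEncoding

/-- The number `⌈log₂ (M + 1)⌉` of bits of a pointer. -/
def pointerBits (M : ℕ) : ℕ := Nat.clog 2 (M + 1)

/-- The number `⌈log₂ F⌉` of most significant bits of a pointer. -/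
def msbBits (F : ℕ) : ℕ := Nat.clog 2 F

/-- The number of least significant bits of a pointer. -/
def lsbBits (M F : ℕ) : ℕ := pointerBits M - msbBits F

/-- The placeholder for "no fermion": the all-ones pointer. Since positions are numbered
`0, …, M - 1` it is larger than every position. -/
def noFermion (M : ℕ) : ℕ := 2 ^ pointerBits M - 1

/-- The `i`-th pointer: the `i`-th smallest occupied position of `b`, and the placeholder if fewer
than `i + 1` positions are occupied. -/
def pointer {M : ℕ} (b : Fin M → Bool) (i : ℕ) : ℕ :=
  (((Finset.univ.filter fun j => b j = true).sort (· ≤ ·)).map Fin.val).getD i (noFermion M)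

/-- The least significant bits of a pointer, as a list (lowest bit first). -/
def lsbRegister (M F p : ℕ) : List Bool :=
  List.ofFn fun k : Fin (lsbBits M F) => p.testBit k

/-- The number of the `F` pointers whose most significant bits have the value `v`. -/
def msbCount {M : ℕ} (F : ℕ) (b : Fin M → Bool) (v : ℕ) : ℕ :=
  (Finset.univ.filter fun i : Fin F => pointer b i / 2 ^ lsbBits M F = v).card

/-- The stars-and-bars string `1^{r_0} 0 1^{r_1} 0 … 0 1^{r_{2^G - 1}}` of the most significant
bits, where `G = msbBits F` and `r_v = msbCount F b v`. -/
def msbString {M : ℕ} (F : ℕ) (b : Fin M → Bool) : List Bool :=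
  List.intercalate [false]
    (List.ofFn fun v : Fin (2 ^ msbBits F) => List.replicate (msbCount F b v) true)

/-- The encoded string: the `F` registers of least significant bits, in the order of the pointers,
followed by the stars-and-bars string. -/
def succinctList {M : ℕ} (F : ℕ) (b : Fin M → Bool) : List Bool :=
  (List.ofFn fun i : Fin F => lsbRegister M F (pointer b i)).flatten ++ msbString F b

/-- The length of the encoded string: `F` registers, `F` stars and `2^G - 1` bars. -/
def succinctLength (M F : ℕ) : ℕ := F * lsbBits M F + (F + (2 ^ msbBits F - 1))

/-- The encoded string as a function on bit positions. -/
def succinctEncoding {M : ℕ} (F : ℕ) (b : Fin M → Bool) : Fin (succinctLength M F) → Bool :=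
  fun q => (succinctList F b).getD q false

end FermionEncoding

open FermionEncoding

noncomputable section

namespace FermionEncoding

set_option linter.unusedSectionVars false


/-! ### Circuits acting on computational basis states -/

/-! Qubits. Put G = `msbBits F`, w = `lsbBits M F` and L = `pointerBits M`. From 2^L ≤ 2M, F ≤ 2^G
and (M/F)^F ≤ binom(M,F) it follows that the F registers of w bits take at most `infoBound M F` + F
qubits (`mul_lsbBits_le`). For F > 0 the stars and bars take fewer than 3F further qubits, and there
are 30F ancillas.

Circuits. Apart from one sign, every query is a classical reversible computation. It is handled as a
permutation of bit assignments written as a product of NOT, CNOT and Toffoli gates (`HasCost`), each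
of which costs at most 34 gates of the given set (`HasCost.exists_circuit`). Since costs are
attached to permutations, adjacent uncompute/compute pairs cancel in the group and need not be paid
for.

Comparison. The main subroutine `lessGate` adds to a flag, for every k < F, whether the k-th pointer
is smaller than a constant c. The most significant bits of a pointer are at least v exactly if the
first v + k places of the stars and bars contain at least v bars (`le_zerosBelow_starBit_iff`), so
one sweep of a counter over the string serves all k in O(F G) gates. The low bits are compared one
register at a time. Since w need not be O(F), there is no room for w clean ancillas; each half of a
register is borrowed, dirty, while the other half is compared (`compareGate_apply`).

Rank. The number of flags set is the number of ones below c. Its parity is computed into one wire, a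
sign is applied to that wire, and the computation is undone.

Flip. Deleting position j moves its register to the end, moves its star to the end, and turns its
low bits into those of the all-ones placeholder (`rotateGate_memory_true`). Insertion is the inverse
of deletion, and a wire holding the bit at j selects between the two (`flipGate_memory`). All
pointer arithmetic rests on `pointer_lt_iff`. -/

theorem Circuit.matrix_append {n : ℕ} (c d : Circuit n) :
    Circuit.matrix (c ++ d) = Circuit.matrix d * Circuit.matrix c := by
  induction c with
  | nil => simp [Circuit.matrix]
  | cons g c ih => simp [Circuit.matrix, ih, Matrix.mul_assoc]

theorem Circuit.apply_append {n : ℕ} (c d : Circuit n) (ψ : QubitSpace n) :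
    Circuit.apply (c ++ d) ψ = Circuit.apply d (Circuit.apply c ψ) := by
  simp only [Circuit.apply, Circuit.matrix_append, Matrix.toLpLin_apply,
    Matrix.mulVec_mulVec]

theorem Circuit.apply_nil {n : ℕ} (ψ : QubitSpace n) : Circuit.apply [] ψ = ψ := by
  simp [Circuit.apply, Circuit.matrix]

theorem Circuit.apply_cons {n : ℕ} (g : Gate n) (c : Circuit n) (ψ : QubitSpace n) :
    Circuit.apply (g :: c) ψ = Circuit.apply c (Circuit.apply [g] ψ) :=
  Circuit.apply_append [g] c ψ

theorem Circuit.apply_singleton_ket {n : ℕ} (g : Gate n) (x y : Fin n → Bool) :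
    Circuit.apply [g] (ket x) y = g.matrix y x := by
  simp [Circuit.apply, Circuit.matrix, ket, Matrix.toLpLin_apply]

theorem ket_apply {n : ℕ} (x y : Fin n → Bool) : ket x y = if y = x then 1 else 0 := by
  simp [ket]

/-- The phase of the `T` gate. -/
def eighthRoot : ℂ := Complex.exp (Complex.I * Real.pi / 4)

theorem eighthRoot_pow_four : eighthRoot ^ 4 = -1 := by
  rw [eighthRoot, ← Complex.exp_nat_mul, ← Complex.exp_pi_mul_I]
  congr 1
  push_cast
  ring

theorem apply_cnot {n : ℕ} (c t : Fin n) (h : c ≠ t) (x : Fin n → Bool) :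
    Circuit.apply [.cnot c t h] (ket x) = ket (Function.update x t (x t ^^ x c)) := by
  ext y
  rw [Circuit.apply_singleton_ket, ket_apply]
  cases hc : x c <;> simp [Gate.matrix, hc]

theorem apply_tGate {n : ℕ} (i : Fin n) (x : Fin n → Bool) :
    Circuit.apply [.tGate i] (ket x) = eighthRoot ^ (x i).toNat • ket x := by
  ext y
  rw [Circuit.apply_singleton_ket, PiLp.smul_apply, ket_apply]
  by_cases h : y = x
  · subst h
    cases hc : y i <;> simp [Gate.matrix, hc, eighthRoot]
  · simp [Gate.matrix, h]

theorem apply_replicate_tGate {n : ℕ} (i : Fin n) (x : Fin n → Bool) (k : ℕ) :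
    Circuit.apply (List.replicate k (.tGate i)) (ket x) =
      eighthRoot ^ (k * (x i).toNat) • ket x := by
  induction k with
  | zero => simp [Circuit.apply_nil]
  | succ k ih =>
    rw [List.replicate_succ, Circuit.apply_cons, apply_tGate, map_smul, ih, smul_smul, ← pow_add]
    congr 2
    ring

theorem apply_hadamard {n : ℕ} (i : Fin n) (x : Fin n → Bool) :
    Circuit.apply [.hadamard i] (ket x) =
      ((Real.sqrt 2 : ℂ))⁻¹ • (ket (Function.update x i false) +
        ((-1) ^ (x i).toNat : ℂ) • ket (Function.update x i true)) := by
  ext y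
  rw [Circuit.apply_singleton_ket, PiLp.smul_apply, PiLp.add_apply, PiLp.smul_apply,
    ket_apply, ket_apply]
  by_cases h : ∀ k, k ≠ i → y k = x k
  · have hy : ∀ v, y = Function.update x i v ↔ y i = v := fun v => by
      constructor
      · intro h'; rw [h']; simp
      · intro h'; ext k
        by_cases hk : k = i
        · subst hk; simp [h']
        · simp [hk, h k hk]
    simp only [Gate.matrix, hy, if_pos h]
    cases y i <;> simp [div_eq_inv_mul]
  · have hy : ∀ v, y ≠ Function.update x i v := fun v h' => h fun k hk => by
      rw [h']; simp [hk]
    simp [Gate.matrix, h, hy]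

/-- Conjugating a controlled sign by Hadamard gates on a target wire flips the target. -/
theorem apply_hadamard_conj {n : ℕ} (t : Fin n) (P : (Fin n → Bool) → Bool)
    (hP : ∀ x b, P (Function.update x t b) = P x) (c : Circuit n)
    (hc : ∀ x, Circuit.apply c (ket x) = ((-1) ^ (x t && P x).toNat : ℂ) • ket x)
    (x : Fin n → Bool) :
    Circuit.apply ([.hadamard t] ++ c ++ [.hadamard t]) (ket x) =
      ket (Function.update x t (x t ^^ P x)) := by
  have h2 : ((Real.sqrt 2 : ℂ))⁻¹ * ((Real.sqrt 2 : ℂ))⁻¹ = 1 / 2 := by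
    rw [← mul_inv, ← Complex.ofReal_mul, Real.mul_self_sqrt (by norm_num)]
    norm_num
  rw [Circuit.apply_append, Circuit.apply_append, apply_hadamard]
  simp only [map_smul, map_add, hc, apply_hadamard, hP, Function.update_self,
    Function.update_idem, smul_add, smul_smul]
  -- The two Hadamard gates leave four terms of weight 1/2. The terms whose bit at `t` is wrong
  -- cancel, and those with the right bit add up; `hu` and `hv` are the two possible sign patterns.
  have hu : ∀ u v : QubitSpace n,
      (2⁻¹ : ℂ) • u + (2⁻¹ : ℂ) • v + ((2⁻¹ : ℂ) • u + -((2⁻¹ : ℂ) • v)) = u := fun u v => by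
    rw [add_add_add_comm, add_neg_cancel, add_zero, ← add_smul]
    norm_num
  have hv : ∀ u v : QubitSpace n,
      (2⁻¹ : ℂ) • u + (2⁻¹ : ℂ) • v + (-((2⁻¹ : ℂ) • u) + (2⁻¹ : ℂ) • v) = v := fun u v => by
    rw [add_add_add_comm, add_neg_cancel, zero_add, ← add_smul]
    norm_num
  rcases hx : x t <;> rcases hp : P x <;> simp [h2, hu, hv]

/-- The sign of one wire. -/
def zCircuit {n : ℕ} (i : Fin n) : Circuit n := List.replicate 4 (.tGate i)

theorem apply_zCircuit {n : ℕ} (i : Fin n) (x : Fin n → Bool) :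
    Circuit.apply (zCircuit i) (ket x) = ((-1) ^ (x i).toNat : ℂ) • ket x := by
  rw [zCircuit, apply_replicate_tGate, pow_mul, eighthRoot_pow_four]

/-- The negation of one wire. -/
def notCircuit {n : ℕ} (t : Fin n) : Circuit n := [.hadamard t] ++ zCircuit t ++ [.hadamard t]

theorem apply_notCircuit {n : ℕ} (t : Fin n) (x : Fin n → Bool) :
    Circuit.apply (notCircuit t) (ket x) = ket (Function.update x t (x t ^^ true)) := by
  rw [notCircuit, apply_hadamard_conj t (fun _ => true) (fun _ _ => rfl)]
  intro x
  rw [apply_zCircuit, Bool.and_true]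

/-- The sign of the conjunction of three wires. -/
def cczCircuit {n : ℕ} (a b c : Fin n) (hab : a ≠ b) (hac : a ≠ c) (hbc : b ≠ c) : Circuit n :=
  List.flatten [[.tGate a], [.tGate b], [.tGate c], [.cnot a b hab], List.replicate 7 (.tGate b),
    [.cnot b c hbc], [.tGate c], [.cnot a b hab], [.cnot b c hbc], List.replicate 7 (.tGate c),
    [.cnot a c hac], [.cnot b c hbc], List.replicate 7 (.tGate c), [.cnot b c hbc]]

/-- The phase comes from the identity 4abc = a + b + c - (a⊕b) - (a⊕c) - (b⊕c) + (a⊕b⊕c) for bits,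
with `eighthRoot ^ 4 = -1`. Seven `T` gates act as an inverse `T`. The CNOT gates form the parities
in place and finally restore the wires. -/
theorem apply_cczCircuit {n : ℕ} (a b c : Fin n) (hab : a ≠ b) (hac : a ≠ c) (hbc : b ≠ c)
    (x : Fin n → Bool) :
    Circuit.apply (cczCircuit a b c hab hac hbc) (ket x) =
      ((-1) ^ (x c && (x a && x b)).toNat : ℂ) • ket x := by
  simp only [cczCircuit, List.flatten_cons, List.flatten_nil, Circuit.apply_append,
    Circuit.apply_nil, apply_cnot, apply_tGate, apply_replicate_tGate,
    map_smul, smul_smul]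
  have h8 : eighthRoot ^ 8 = 1 := by
    rw [show 8 = 4 * 2 by norm_num, pow_mul, eighthRoot_pow_four]; norm_num
  simp only [Function.update_self, Function.update_of_ne hab, Function.update_of_ne hac,
    Function.update_of_ne hbc, Function.update_of_ne hbc.symm]
  refine congrArg₂ (fun (r : ℂ) ψ => r • ψ) ?_ (congrArg ket ?_)
  · rcases x a <;> rcases x b <;> rcases x c <;> simp <;>
      first
      | linear_combination (eighthRoot ^ 8 + 1) * h8
      | linear_combination eighthRoot_pow_four
  · funext k
    by_cases hkc : k = c
    · subst hkc
      cases h1 : x a <;> cases h2 : x b <;> cases h3 : x k <;> simp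
    · by_cases hkb : k = b
      · subst hkb
        simp [hkc]
      · simp [hkc, hkb]

/-- The Toffoli gate with controls `a`, `b` and target `t`. -/
def toffoliCircuit {n : ℕ} (a b t : Fin n) (hab : a ≠ b) (hat : a ≠ t) (hbt : b ≠ t) : Circuit n :=
  [.hadamard t] ++ cczCircuit a b t hab hat hbt ++ [.hadamard t]

theorem apply_toffoliCircuit {n : ℕ} (a b t : Fin n) (hab : a ≠ b) (hat : a ≠ t) (hbt : b ≠ t)
    (x : Fin n → Bool) :
    Circuit.apply (toffoliCircuit a b t hab hat hbt) (ket x) =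
      ket (Function.update x t (x t ^^ (x a && x b))) := by
  rw [toffoliCircuit, apply_hadamard_conj t (fun x => x a && x b) (by simp [hat, hbt])]
  exact apply_cczCircuit a b t hab hat hbt

theorem length_toffoliCircuit {n : ℕ} (a b t : Fin n) (hab : a ≠ b) (hat : a ≠ t) (hbt : b ≠ t) :
    (toffoliCircuit a b t hab hat hbt).length = 34 := by
  simp [toffoliCircuit, cczCircuit]

/-! ### Reversible classical circuits -/

section Reversible

variable {ι : Type*} [DecidableEq ι]

/-- The value of `P` does not depend on the wire `t`. -/
def IgnoresWire (t : ι) (P : (ι → Bool) → Bool) : Prop :=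
  ∀ s b, P (Function.update s t b) = P s

/-- The permutation adding the value of `P` to the wire `t`; the wire `t` is read as zero
by `P`. -/
def xorAt (t : ι) (P : (ι → Bool) → Bool) : Equiv.Perm (ι → Bool) where
  toFun s := Function.update s t (s t ^^ P (Function.update s t false))
  invFun s := Function.update s t (s t ^^ P (Function.update s t false))
  left_inv s := by simp
  right_inv s := by simp

theorem xorAt_apply {t : ι} {P : (ι → Bool) → Bool} (hP : IgnoresWire t P) (s : ι → Bool) :
    xorAt t P s = Function.update s t (s t ^^ P s) := by
  change Function.update s t (s t ^^ P (Function.update s t false)) = _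
  rw [hP]

theorem xorAt_apply_of_ne {t y : ι} (h : y ≠ t) (P : (ι → Bool) → Bool) (s : ι → Bool) :
    xorAt t P s y = s y :=
  Function.update_of_ne h _ _

/-- Used to implement a compound condition on one target as several elementary gates, for instance a
negated control as CNOT and NOT. -/
theorem xorAt_mul_xorAt {t : ι} {P Q : (ι → Bool) → Bool} (hP : IgnoresWire t P)
    (hQ : IgnoresWire t Q) : xorAt t P * xorAt t Q = xorAt t fun s => Q s ^^ P s := by
  ext s : 1
  have h : IgnoresWire t fun s => Q s ^^ P s := fun s b => by
    change (Q _ ^^ P _) = _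
    rw [hP, hQ]
  rw [Equiv.Perm.mul_apply, xorAt_apply hQ, xorAt_apply hP, xorAt_apply h, hP]
  simp

theorem ignoresWire_const (t : ι) (b : Bool) : IgnoresWire t fun _ => b := fun _ _ => rfl

theorem ignoresWire_coord {a t : ι} (h : a ≠ t) : IgnoresWire t fun s => s a :=
  fun s b => Function.update_of_ne h b s

theorem IgnoresWire.map₂ {t : ι} {P Q : (ι → Bool) → Bool} (hP : IgnoresWire t P)
    (hQ : IgnoresWire t Q) (f : Bool → Bool → Bool) : IgnoresWire t fun s => f (P s) (Q s) :=
  fun s b => by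
    change f (P _) (Q _) = _
    rw [hP, hQ]

/-- The NOT gate. -/
def notGate (t : ι) : Equiv.Perm (ι → Bool) := xorAt t fun _ => true

/-- The controlled NOT gate with control `a`. -/
def cnotGate (a t : ι) : Equiv.Perm (ι → Bool) := xorAt t fun s => s a

/-- The Toffoli gate with controls `a` and `b`. -/
def tofGate (a b t : ι) : Equiv.Perm (ι → Bool) := xorAt t fun s => s a && s b

theorem notGate_apply (t : ι) (s : ι → Bool) :
    notGate t s = Function.update s t (!s t) := by
  rw [notGate, xorAt_apply (ignoresWire_const t true), Bool.xor_true]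

theorem cnotGate_apply {a t : ι} (h : a ≠ t) (s : ι → Bool) :
    cnotGate a t s = Function.update s t (s t ^^ s a) :=
  xorAt_apply (ignoresWire_coord h) s

theorem tofGate_apply {a b t : ι} (ha : a ≠ t) (hb : b ≠ t) (s : ι → Bool) :
    tofGate a b t s = Function.update s t (s t ^^ (s a && s b)) :=
  xorAt_apply ((ignoresWire_coord ha).map₂ (ignoresWire_coord hb) and) s

/-- The gates of reversible circuits on the set `V` of wires. -/
inductive IsElementary (V : Set ι) : Equiv.Perm (ι → Bool) → Prop
  | not {t : ι} (ht : t ∈ V) : IsElementary V (notGate t)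
  | cnot {a t : ι} (ha : a ∈ V) (ht : t ∈ V) (hat : a ≠ t) : IsElementary V (cnotGate a t)
  | tof {a b t : ι} (ha : a ∈ V) (hb : b ∈ V) (ht : t ∈ V) (hab : a ≠ b) (hat : a ≠ t)
      (hbt : b ≠ t) : IsElementary V (tofGate a b t)

theorem IsElementary.inv {V : Set ι} {π : Equiv.Perm (ι → Bool)} (h : IsElementary V π) :
    π⁻¹ = π := by
  cases h <;> rfl

/-- The permutation `π` is a product of at most `N` gates on the wires in `V`. -/
def HasCost (V : Set ι) (π : Equiv.Perm (ι → Bool)) (N : ℕ) : Prop :=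
  ∃ l : List (Equiv.Perm (ι → Bool)), (∀ g ∈ l, IsElementary V g) ∧ l.length ≤ N ∧ l.prod = π

/-! ### Gate counts of permutations -/

section Cost

variable {V : Set ι} {π ρ : Equiv.Perm (ι → Bool)} {N N' : ℕ}

theorem IsElementary.hasCost (h : IsElementary V π) : HasCost V π 1 :=
  ⟨[π], by simpa using h, le_rfl, by simp⟩

theorem HasCost.one : HasCost V (1 : Equiv.Perm (ι → Bool)) 0 := ⟨[], by simp, le_rfl, rfl⟩

theorem HasCost.mono (h : HasCost V π N) (hN : N ≤ N') : HasCost V π N' := by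
  obtain ⟨l, h1, h2, h3⟩ := h
  exact ⟨l, h1, h2.trans hN, h3⟩

theorem HasCost.mul (h : HasCost V π N) (h' : HasCost V ρ N') : HasCost V (π * ρ) (N + N') := by
  obtain ⟨l, h1, h2, rfl⟩ := h
  obtain ⟨l', h1', h2', rfl⟩ := h'
  refine ⟨l ++ l', fun g hg => ?_, ?_, List.prod_append⟩
  · rcases List.mem_append.1 hg with hg | hg
    exacts [h1 g hg, h1' g hg]
  · rw [List.length_append]
    omega

/-- All three gates are involutions, so the reversed list implements the inverse. -/
theorem HasCost.inv (h : HasCost V π N) : HasCost V π⁻¹ N := by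
  obtain ⟨l, h1, h2, rfl⟩ := h
  refine ⟨l.reverse, fun g hg => h1 g (List.mem_reverse.1 hg), by simpa using h2, ?_⟩
  rw [List.prod_inv_reverse]
  congr 2
  symm
  calc l.map (fun x => x⁻¹) = l.map id := List.map_congr_left fun g hg => (h1 g hg).inv
    _ = l := List.map_id l

theorem hasCost_notGate {t : ι} (ht : t ∈ V) : HasCost V (notGate t) 1 :=
  (IsElementary.not ht).hasCost

theorem hasCost_cnotGate {a t : ι} (ha : a ∈ V) (ht : t ∈ V) (hat : a ≠ t) :
    HasCost V (cnotGate a t) 1 :=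
  (IsElementary.cnot ha ht hat).hasCost

theorem hasCost_tofGate {a b t : ι} (ha : a ∈ V) (hb : b ∈ V) (ht : t ∈ V) (hab : a ≠ b)
    (hat : a ≠ t) (hbt : b ≠ t) : HasCost V (tofGate a b t) 1 :=
  (IsElementary.tof ha hb ht hab hat hbt).hasCost

end Cost

/-- The product applying `f 0`, then `f 1`, …, and finally `f (n - 1)`. -/
def seqProd {G : Type*} [Group G] (f : ℕ → G) : ℕ → G
  | 0 => 1
  | n + 1 => f n * seqProd f n

theorem HasCost.seqProd {V : Set ι} {f : ℕ → Equiv.Perm (ι → Bool)} {n K : ℕ}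
    (h : ∀ i < n, HasCost V (f i) K) : HasCost V (seqProd f n) (n * K) := by
  induction n with
  | zero => exact HasCost.one.mono (Nat.zero_le _)
  | succ n ih =>
    exact ((h n n.lt_succ_self).mul (ih fun i hi => h i (hi.trans n.lt_succ_self))).mono
      (by rw [Nat.succ_mul, Nat.add_comm])

theorem seqProd_apply_of_forall {f : ℕ → Equiv.Perm (ι → Bool)} {n : ℕ} (S : ℕ → ι → Bool)
    (h : ∀ i < n, f i (S i) = S (i + 1)) : seqProd f n (S 0) = S n := by
  induction n with
  | zero => rfl
  | succ n ih =>
    change f n (FermionEncoding.seqProd f n (S 0)) = _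
    rw [ih fun i hi => h i (hi.trans n.lt_succ_self), h n n.lt_succ_self]

/-- The permutation `π` neither reads nor changes the wire `t`. -/
def Avoids (t : ι) (π : Equiv.Perm (ι → Bool)) : Prop :=
  ∀ s b, π (Function.update s t b) = Function.update (π s) t b

section Avoids

variable {t : ι} {π ρ : Equiv.Perm (ι → Bool)}

theorem Avoids.apply_self (h : Avoids t π) (s : ι → Bool) : π s t = s t := by
  have := congrFun (h s (s t)) t
  rwa [Function.update_eq_self, Function.update_self] at this

theorem Avoids.one : Avoids t (1 : Equiv.Perm (ι → Bool)) := fun _ _ => rfl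

theorem Avoids.mul (h : Avoids t π) (h' : Avoids t ρ) : Avoids t (π * ρ) := fun s b => by
  rw [Equiv.Perm.mul_apply, h', h, Equiv.Perm.mul_apply]

theorem Avoids.inv (h : Avoids t π) : Avoids t π⁻¹ := fun s b => by
  rw [Equiv.Perm.inv_eq_iff_eq, h, ← Equiv.Perm.mul_apply, mul_inv_cancel, Equiv.Perm.one_apply]

theorem Avoids.xorAt {r : ι} {P : (ι → Bool) → Bool} (hr : r ≠ t) (hP : IgnoresWire t P) :
    Avoids t (xorAt r P) := fun s b => by
  change Function.update (Function.update s t b) r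
      (Function.update s t b r ^^ P (Function.update (Function.update s t b) r false)) =
    Function.update (Function.update s r _) t b
  rw [Function.update_comm hr.symm, Function.update_of_ne hr,
    Function.update_comm hr.symm, hP]

theorem Avoids.notGate {r : ι} (hr : r ≠ t) : Avoids t (notGate r) :=
  Avoids.xorAt hr (ignoresWire_const t true)

theorem Avoids.cnotGate {a r : ι} (ha : a ≠ t) (hr : r ≠ t) : Avoids t (cnotGate a r) :=
  Avoids.xorAt hr (ignoresWire_coord ha)

theorem Avoids.tofGate {a b r : ι} (ha : a ≠ t) (hb : b ≠ t) (hr : r ≠ t) :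
    Avoids t (tofGate a b r) :=
  Avoids.xorAt hr ((ignoresWire_coord ha).map₂ (ignoresWire_coord hb) and)

theorem Avoids.seqProd {f : ℕ → Equiv.Perm (ι → Bool)} {n : ℕ} (h : ∀ i < n, Avoids t (f i)) :
    Avoids t (seqProd f n) := by
  induction n with
  | zero => exact Avoids.one
  | succ n ih => exact (h n n.lt_succ_self).mul (ih fun i hi => h i (hi.trans n.lt_succ_self))

/-- Compute, add the computed value to `t`, and uncompute. -/
theorem Avoids.conj_xorAt_apply (h : Avoids t π) {P : (ι → Bool) → Bool} (hP : IgnoresWire t P)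
    (s : ι → Bool) :
    (π⁻¹ * FermionEncoding.xorAt t P * π) s = Function.update s t (s t ^^ P (π s)) := by
  rw [Equiv.Perm.mul_apply, Equiv.Perm.mul_apply, Equiv.Perm.inv_eq_iff_eq, xorAt_apply hP, h,
    h.apply_self]

end Avoids

/-- The permutation `π` does not change the wire `y`. -/
def Fixes (y : ι) (π : Equiv.Perm (ι → Bool)) : Prop := ∀ s, π s y = s y

section Fixes

variable {y : ι} {π ρ : Equiv.Perm (ι → Bool)}

theorem Fixes.one : Fixes y (1 : Equiv.Perm (ι → Bool)) := fun _ => rfl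

theorem Fixes.mul (h : Fixes y π) (h' : Fixes y ρ) : Fixes y (π * ρ) := fun s => by
  rw [Equiv.Perm.mul_apply, h, h']

theorem Fixes.inv (h : Fixes y π) : Fixes y π⁻¹ := fun s => by
  rw [← h (π⁻¹ s), ← Equiv.Perm.mul_apply, mul_inv_cancel, Equiv.Perm.one_apply]

theorem Fixes.xorAt {r : ι} (h : y ≠ r) (P : (ι → Bool) → Bool) : Fixes y (xorAt r P) :=
  xorAt_apply_of_ne h P

end Fixes

/-- Reversible circuits are quantum circuits. -/
theorem HasCost.exists_circuit {n : ℕ} {dec : Fin n → ι} (hdec : Function.Injective dec)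
    {π : Equiv.Perm (ι → Bool)} {N : ℕ} (h : HasCost (Set.range dec) π N) :
    ∃ c : Circuit n, c.length ≤ 34 * N ∧
      ∀ s : ι → Bool, Circuit.apply c (ket (s ∘ dec)) = ket (π s ∘ dec) := by
  obtain ⟨l, hl, hN, rfl⟩ := h
  suffices ∃ c : Circuit n, c.length ≤ 34 * l.length ∧
      ∀ s : ι → Bool, Circuit.apply c (ket (s ∘ dec)) = ket (l.prod s ∘ dec) by
    obtain ⟨c, hc, hc'⟩ := this
    exact ⟨c, hc.trans (by omega), hc'⟩
  clear hN
  induction l with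
  | nil => exact ⟨[], by simp, fun s => by rw [Circuit.apply_nil]; rfl⟩
  | cons g l ih =>
    obtain ⟨c, hc, hcs⟩ := ih fun g hg => hl g (List.mem_cons_of_mem _ hg)
    -- The Toffoli gate is the worst case; NOT takes 6 gates and CNOT takes 1. Injectivity of `dec`
    -- turns the update of a wire into the update of a single qubit.
    have hg : ∃ d : Circuit n, d.length ≤ 34 ∧
        ∀ s : ι → Bool, Circuit.apply d (ket (s ∘ dec)) = ket (g s ∘ dec) := by
      cases hl g List.mem_cons_self with
      | not ht =>
        obtain ⟨i, rfl⟩ := ht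
        refine ⟨notCircuit i, by simp [notCircuit, zCircuit], fun s => ?_⟩
        rw [apply_notCircuit, notGate_apply, Function.update_comp_eq_of_injective _ hdec]
        simp
      | cnot ha ht hat =>
        obtain ⟨i, rfl⟩ := ht
        obtain ⟨a, rfl⟩ := ha
        refine ⟨[.cnot a i fun h => hat (congrArg dec h)], by simp, fun s => ?_⟩
        rw [apply_cnot, cnotGate_apply hat, Function.update_comp_eq_of_injective _ hdec]
        rfl
      | tof ha hb ht hab hat hbt =>
        obtain ⟨i, rfl⟩ := ht
        obtain ⟨a, rfl⟩ := ha
        obtain ⟨b, rfl⟩ := hb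
        refine ⟨toffoliCircuit a b i (fun h => hab (congrArg dec h))
          (fun h => hat (congrArg dec h)) (fun h => hbt (congrArg dec h)),
          (length_toffoliCircuit ..).le, fun s => ?_⟩
        rw [apply_toffoliCircuit, tofGate_apply hat hbt,
          Function.update_comp_eq_of_injective _ hdec]
        rfl
    obtain ⟨d, hd, hds⟩ := hg
    refine ⟨c ++ d, ?_, fun s => ?_⟩
    · rw [List.length_append, List.length_cons]
      omega
    · rw [Circuit.apply_append, hcs, hds, List.prod_cons, Equiv.Perm.mul_apply]

end Reversible

section Subroutines

variable {ι : Type*} [DecidableEq ι]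

/-! ### Adding values to a family of wires -/

/-- The state obtained by adding the bits `v 0, …, v (n - 1)` to the wires `x 0, …, x (n - 1)`. -/
def addTo (x : ℕ → ι) (v : ℕ → Bool) : ℕ → (ι → Bool) → ι → Bool
  | 0, s => s
  | n + 1, s => Function.update (addTo x v n s) (x n) (addTo x v n s (x n) ^^ v n)

theorem addTo_apply_of_forall_ne {x : ℕ → ι} {v : ℕ → Bool} {n : ℕ} {s : ι → Bool} {y : ι}
    (h : ∀ i < n, y ≠ x i) : addTo x v n s y = s y := by
  induction n with
  | zero => rfl
  | succ n ih =>
    rw [addTo, Function.update_of_ne (h n n.lt_succ_self),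
      ih fun i hi => h i (hi.trans n.lt_succ_self)]

theorem addTo_apply {x : ℕ → ι} (hx : Function.Injective x) {v : ℕ → Bool} {n : ℕ}
    {s : ι → Bool} {i : ℕ} (hi : i < n) : addTo x v n s (x i) = (s (x i) ^^ v i) := by
  induction n with
  | zero => omega
  | succ n ih =>
    rw [addTo]
    rcases Nat.lt_succ_iff_lt_or_eq.1 hi with h | rfl
    · rw [Function.update_of_ne (hx.ne h.ne), ih h]
    · rw [Function.update_self, addTo_apply_of_forall_ne fun j hj => hx.ne hj.ne']

/-- Each factor may read any wire outside the family `x`, because these keep their initial values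
throughout. It therefore suffices to know the action of `f i` on states that agree with `s` off the
family. -/
theorem seqProd_eq_addTo {x : ℕ → ι} {v : ℕ → Bool} {n : ℕ} {s : ι → Bool}
    {f : ℕ → Equiv.Perm (ι → Bool)}
    (h : ∀ i < n, ∀ s' : ι → Bool, (∀ y, (∀ j < n, y ≠ x j) → s' y = s y) →
      f i s' = Function.update s' (x i) (s' (x i) ^^ v i)) :
    seqProd f n s = addTo x v n s := by
  suffices ∀ m ≤ n, seqProd f m s = addTo x v m s from this n le_rfl
  intro m
  induction m with
  | zero => exact fun _ => rfl
  | succ m ih =>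
    intro hm
    rw [addTo, seqProd, Equiv.Perm.mul_apply, ih (by omega), h m hm]
    exact fun y hy => addTo_apply_of_forall_ne fun j hj => hy j (by omega)

/-- Negate the wires `x i` with `i < n` and `c i`. -/
def flipGates (x : ℕ → ι) (c : ℕ → Bool) (n : ℕ) : Equiv.Perm (ι → Bool) :=
  seqProd (fun i => if c i then notGate (x i) else 1) n

theorem flipGates_apply (x : ℕ → ι) (c : ℕ → Bool) (n : ℕ) (s : ι → Bool) :
    flipGates x c n s = addTo x c n s := by
  refine seqProd_eq_addTo fun i _ s' _ => ?_
  cases h : c i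
  · simp
  · simp [notGate_apply]

theorem hasCost_flipGates {V : Set ι} {x : ℕ → ι} {n : ℕ} (h : ∀ i < n, x i ∈ V) (c : ℕ → Bool) :
    HasCost V (flipGates x c n) n := by
  refine (HasCost.seqProd (K := 1) fun i hi => ?_).mono (by omega)
  cases c i
  · exact HasCost.one.mono (by simp)
  · exact hasCost_notGate (h i hi)

theorem avoids_flipGates {x : ℕ → ι} {n : ℕ} {y : ι} (h : ∀ i < n, x i ≠ y) (c : ℕ → Bool) :
    Avoids y (flipGates x c n) := by
  refine Avoids.seqProd fun i hi => ?_
  cases c i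
  · exact Avoids.one
  · exact Avoids.notGate (h i hi)

/-! ### Comparison with a constant, on borrowed wires -/

/-- Comparing the number with binary digits `s (x 0), …, s (x (n - 1))` with the number with
binary digits `c 0, …, c (n - 1)`; the wire `z` breaks ties. -/
def comparison (x : ℕ → ι) (c : ℕ → Bool) (z : ι) : ℕ → (ι → Bool) → Bool
  | 0, s => s z
  | n + 1, s => if s (x n) = c n then comparison x c z n s else c n

theorem comparison_congr {x : ℕ → ι} {c : ℕ → Bool} {z : ι} {n : ℕ} {s s' : ι → Bool}
    (hz : s z = s' z) (hx : ∀ i < n, s (x i) = s' (x i)) :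
    comparison x c z n s = comparison x c z n s' := by
  induction n with
  | zero => exact hz
  | succ n ih =>
    rw [comparison, comparison, hx n n.lt_succ_self, ih fun i hi => hx i (hi.trans n.lt_succ_self)]

/-- Add `s d` to `t` if `s x = b`. -/
def matchGate (b : Bool) (x d t : ι) : Equiv.Perm (ι → Bool) :=
  if b then tofGate x d t else notGate x * tofGate x d t * notGate x

theorem matchGate_apply (b : Bool) {x d t : ι} (hxd : x ≠ d) (hxt : x ≠ t) (hdt : d ≠ t)
    (s : ι → Bool) :
    matchGate b x d t s = Function.update s t (s t ^^ (s x == b && s d)) := by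
  cases b
  · simp only [matchGate, Bool.false_eq_true, if_false, Equiv.Perm.mul_apply, notGate_apply,
      tofGate_apply hxt hdt, Function.update_self, Function.update_of_ne hxt,
      Function.update_of_ne hxd.symm, Function.update_of_ne hxt.symm]
    rw [Function.update_comm hxt.symm, Function.update_idem]
    simp
  · simp [matchGate, tofGate_apply hxt hdt]

theorem hasCost_matchGate {V : Set ι} (b : Bool) {x d t : ι} (hx : x ∈ V) (hd : d ∈ V)
    (ht : t ∈ V) (hxd : x ≠ d) (hxt : x ≠ t) (hdt : d ≠ t) : HasCost V (matchGate b x d t) 3 := by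
  have h := hasCost_tofGate hx hd ht hxd hxt hdt
  cases b
  · exact ((hasCost_notGate hx).mul h).mul (hasCost_notGate hx)
  · exact h.mono (by norm_num)

theorem avoids_matchGate (b : Bool) {x d t y : ι} (hx : x ≠ y) (hd : d ≠ y) (ht : t ≠ y) :
    Avoids y (matchGate b x d t) := by
  have h := Avoids.tofGate hx hd ht
  cases b
  · exact ((Avoids.notGate hx).mul h).mul (Avoids.notGate hx)
  · exact h

/-- Add to `t` the value `b` if `s x ≠ b`. -/
def mismatchGate (b : Bool) (x t : ι) : Equiv.Perm (ι → Bool) :=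
  if b then notGate t * cnotGate x t else 1

theorem mismatchGate_apply (b : Bool) {x t : ι} (hxt : x ≠ t) (s : ι → Bool) :
    mismatchGate b x t s = Function.update s t (s t ^^ (b && !(s x))) := by
  cases b
  · simp [mismatchGate]
  · simp [mismatchGate, notGate_apply, cnotGate_apply hxt]

theorem hasCost_mismatchGate {V : Set ι} (b : Bool) {x t : ι} (hx : x ∈ V) (ht : t ∈ V)
    (hxt : x ≠ t) : HasCost V (mismatchGate b x t) 2 := by
  cases b
  · exact HasCost.one.mono (by norm_num)
  · exact (hasCost_notGate ht).mul (hasCost_cnotGate hx ht hxt)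

theorem avoids_mismatchGate (b : Bool) {x t y : ι} (hx : x ≠ y) (ht : t ≠ y) :
    Avoids y (mismatchGate b x t) := by
  cases b
  · exact Avoids.one
  · exact (Avoids.notGate ht).mul (Avoids.cnotGate hx ht)

/-- Adds the comparison of `n` digits to `t`, and the comparisons of fewer digits to the wires
`d`. -/
def ladder (x : ℕ → ι) (c : ℕ → Bool) (d : ℕ → ι) (z : ι) : ℕ → ι → Equiv.Perm (ι → Bool)
  | 0, t => cnotGate z t
  | n + 1, t => matchGate (c n) (x n) (d n) t * ladder x c d z n (d n) *
      matchGate (c n) (x n) (d n) t * mismatchGate (c n) (x n) t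

section Ladder

variable {x : ℕ → ι} {c : ℕ → Bool} {d : ℕ → ι} {z : ι}

theorem avoids_ladder {y : ι} {n : ℕ} {t : ι} (hx : ∀ i < n, x i ≠ y) (hd : ∀ i < n, d i ≠ y)
    (hz : z ≠ y) (ht : t ≠ y) : Avoids y (ladder x c d z n t) := by
  induction n generalizing t with
  | zero => exact Avoids.cnotGate hz ht
  | succ n ih =>
    have hm := avoids_matchGate (c n) (hx n n.lt_succ_self) (hd n n.lt_succ_self) ht
    exact ((hm.mul (ih (fun i hi => hx i (by omega)) (fun i hi => hd i (by omega))
      (hd n n.lt_succ_self))).mul hm).mul (avoids_mismatchGate _ (hx n n.lt_succ_self) ht)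

theorem hasCost_ladder {V : Set ι} {n : ℕ} {t : ι} (hd : ∀ i j, i < n → j < i → d i ≠ d j)
    (hxd : ∀ i < n, ∀ j < n, x i ≠ d j) (hzd : ∀ j < n, z ≠ d j) (hxt : ∀ i < n, x i ≠ t)
    (hdt : ∀ i < n, d i ≠ t) (hzt : z ≠ t)
    (hxV : ∀ i < n, x i ∈ V) (hdV : ∀ i < n, d i ∈ V) (hzV : z ∈ V) (htV : t ∈ V) :
    HasCost V (ladder x c d z n t) (8 * n + 1) := by
  induction n generalizing t with
  | zero => exact hasCost_cnotGate hzV htV hzt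
  | succ n ih =>
    have hn := n.lt_succ_self
    have hm := hasCost_matchGate (c n) (hxV n hn) (hdV n hn) htV (hxd n hn n hn) (hxt n hn)
      (hdt n hn)
    refine (((hm.mul (ih (t := d n) ?_ ?_ ?_ ?_ ?_ ?_ ?_ ?_ ?_)).mul hm).mul
      (hasCost_mismatchGate _ (hxV n hn) htV (hxt n hn))).mono (by omega)
    · exact fun i j hi hj => hd i j (by omega) hj
    · exact fun i hi j hj => hxd i (by omega) j (by omega)
    · exact fun j hj => hzd j (by omega)
    · exact fun i hi => hxd i (by omega) n hn
    · exact fun i hi => (hd n i hn hi).symm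
    · exact hzd n hn
    · exact fun i hi => hxV i (by omega)
    · exact fun i hi => hdV i (by omega)
    · exact hdV n hn

/-- The match gates may negate `x n` temporarily, but they restore it. So the operands survive a
ladder, and its inverse can be run before the operands are read. -/
theorem fixes_ladder {y : ι} {n : ℕ} {t : ι} (hd : ∀ i < n, y ≠ d i) (ht : y ≠ t)
    (hxd : ∀ i < n, ∀ j < n, x i ≠ d j) (hxt : ∀ i < n, x i ≠ t) : Fixes y (ladder x c d z n t) := by
  induction n generalizing t with
  | zero => exact (Fixes.xorAt ht fun s => s z : Fixes y (cnotGate z t))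
  | succ n ih =>
    have hn := n.lt_succ_self
    have hL := ih (t := d n) (fun i hi => hd i (by omega)) (hd n hn)
      (fun i hi j hj => hxd i (by omega) j (by omega)) fun i hi => hxd i (by omega) n hn
    have hm : Fixes y (matchGate (c n) (x n) (d n) t) := by
      have h : Fixes y (tofGate (x n) (d n) t) := Fixes.xorAt ht _
      intro s
      cases c n
      · change notGate _ (tofGate _ _ _ (notGate _ s)) y = s y
        by_cases hyx : y = x n
        · subst hyx
          rw [notGate_apply, Function.update_self, h, notGate_apply, Function.update_self,
            Bool.not_not]
        · rw [notGate_apply, Function.update_of_ne hyx, h, notGate_apply,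
            Function.update_of_ne hyx]
      · exact h s
    have ha : Fixes y (mismatchGate (c n) (x n) t) := by
      cases c n
      · exact Fixes.one
      · exact (Fixes.xorAt ht _).mul (Fixes.xorAt ht _)
    exact ((hm.mul hL).mul hm).mul ha

/-- The wire `d n` starts with an unknown value. It is added to `t` once before and once after the
shorter ladder has added its comparison to it, so the unknown value cancels and only the comparison
reaches `t`. The remaining side effect on the wires `d` is exactly that of the shorter ladder, which
makes it removable. -/
theorem ladder_succ_apply {n : ℕ} {t : ι} (hd : ∀ i j, i < n + 1 → j < i → d i ≠ d j)
    (hxd : ∀ i < n + 1, ∀ j < n + 1, x i ≠ d j) (hzd : ∀ j < n + 1, z ≠ d j)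
    (hxt : ∀ i < n + 1, x i ≠ t) (hdt : ∀ i < n + 1, d i ≠ t) (hzt : z ≠ t) (s : ι → Bool) :
    ladder x c d z (n + 1) t s =
      Function.update (ladder x c d z n (d n) s) t (s t ^^ comparison x c z (n + 1) s) := by
  induction n generalizing t s with
  | zero =>
    have h1 := hxt 0 one_pos
    have h2 := hdt 0 one_pos
    have h3 := hxd 0 one_pos 0 one_pos
    have h4 := hzd 0 one_pos
    simp only [ladder, Equiv.Perm.mul_apply, matchGate_apply _ h3 h1 h2, mismatchGate_apply _ h1,
      cnotGate_apply h4, comparison]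
    rw [Function.update_comm h2.symm]
    simp only [Function.update_self, Function.update_of_ne h1, Function.update_of_ne h2,
      Function.update_of_ne h3, Function.update_of_ne hzt, Function.update_idem]
    rw [Function.update_comm h2.symm, Function.update_idem]
    congr 1
    cases s (x 0) <;> cases c 0 <;> cases s (d 0) <;> cases s z <;> simp
  | succ n ih =>
    have hn := (n + 1).lt_succ_self
    have h1 := hxt _ hn
    have h2 := hdt _ hn
    have h3 := hxd _ hn _ hn
    have hA : Avoids t (ladder x c d z (n + 1) (d (n + 1))) :=
      avoids_ladder (fun i hi => hxt i (by omega)) (fun i hi => hdt i (by omega)) hzt h2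
    have hF : ∀ i < n + 2, Fixes (x i) (ladder x c d z (n + 1) (d (n + 1))) := fun i hi =>
      fixes_ladder (fun j hj => hxd i hi j (by omega)) (hxd i hi _ hn)
        (fun i hi j hj => hxd i (by omega) j (by omega)) (fun i hi => hxd i (by omega) _ hn)
    have hL := ih (t := d (n + 1)) (fun i j hi hj => hd i j (by omega) hj)
      (fun i hi j hj => hxd i (by omega) j (by omega)) (fun j hj => hzd j (by omega))
      (fun i hi => hxd i (by omega) _ hn) (fun i hi => (hd _ i hn hi).symm) (hzd _ hn) s
    have hLd : ladder x c d z (n + 1) (d (n + 1)) s (d (n + 1)) =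
        (s (d (n + 1)) ^^ comparison x c z (n + 1) s) := by
      rw [hL, Function.update_self]
    rw [ladder, Equiv.Perm.mul_apply, Equiv.Perm.mul_apply, Equiv.Perm.mul_apply,
      mismatchGate_apply _ h1, matchGate_apply _ h3 h1 h2, matchGate_apply _ h3 h1 h2,
      Function.update_idem, hA]
    simp only [Function.update_self, Function.update_of_ne h1, Function.update_of_ne h2,
      Function.update_idem, hLd, hF _ hn s]
    congr 1
    change _ = (s t ^^ if s (x (n + 1)) = c (n + 1) then comparison x c z (n + 1) s else c (n + 1))
    cases s (x (n + 1)) <;> cases c (n + 1) <;> cases s (d (n + 1)) <;>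
      cases comparison x c z (n + 1) s <;> simp

/-- Add the comparison of `n` digits to `t`, borrowing the wires `d`. -/
def compareGate (x : ℕ → ι) (c : ℕ → Bool) (d : ℕ → ι) (z : ι) (n : ℕ) (t : ι) :
    Equiv.Perm (ι → Bool) :=
  ladder x c d z n t * match n with
    | 0 => 1
    | m + 1 => (ladder x c d z m (d m))⁻¹

variable {n : ℕ} {t : ι}

/-- The inverse of the shorter ladder is applied first, and the full ladder then repeats the shorter
ladder's effect on `d`. The two cancel, so the borrowed wires return to their arbitrary values and
only `t` has changed. -/
theorem compareGate_apply (hd : ∀ i j, i < n → j < i → d i ≠ d j)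
    (hxd : ∀ i < n, ∀ j < n, x i ≠ d j) (hzd : ∀ j < n, z ≠ d j) (hxt : ∀ i < n, x i ≠ t)
    (hdt : ∀ i < n, d i ≠ t) (hzt : z ≠ t) (s : ι → Bool) :
    compareGate x c d z n t s = Function.update s t (s t ^^ comparison x c z n s) := by
  cases n with
  | zero => exact cnotGate_apply hzt s
  | succ n =>
    have hn := n.lt_succ_self
    have hA : Avoids t (ladder x c d z n (d n)) :=
      avoids_ladder (fun i hi => hxt i (by omega)) (fun i hi => hdt i (by omega)) hzt (hdt n hn)
    have hF : ∀ y, (∀ i < n + 1, y ≠ d i) → Fixes y (ladder x c d z n (d n)) := fun y hy =>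
      fixes_ladder (fun j hj => hy j (by omega)) (hy n hn)
        (fun i hi j hj => hxd i (by omega) j (by omega)) (fun i hi => hxd i (by omega) _ hn)
    rw [compareGate, Equiv.Perm.mul_apply, ladder_succ_apply hd hxd hzd hxt hdt hzt,
      ← Equiv.Perm.mul_apply, mul_inv_cancel, Equiv.Perm.one_apply, hA.inv.apply_self]
    congr 2
    exact comparison_congr ((hF z hzd).inv s) fun i hi => (hF _ (hxd i hi)).inv s

theorem hasCost_compareGate {V : Set ι} (hd : ∀ i j, i < n → j < i → d i ≠ d j)
    (hxd : ∀ i < n, ∀ j < n, x i ≠ d j) (hzd : ∀ j < n, z ≠ d j) (hxt : ∀ i < n, x i ≠ t)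
    (hdt : ∀ i < n, d i ≠ t) (hzt : z ≠ t) (hxV : ∀ i < n, x i ∈ V) (hdV : ∀ i < n, d i ∈ V)
    (hzV : z ∈ V) (htV : t ∈ V) : HasCost V (compareGate x c d z n t) (16 * n + 1) := by
  have h := hasCost_ladder (c := c) hd hxd hzd hxt hdt hzt hxV hdV hzV htV
  cases n with
  | zero => exact h.mul HasCost.one
  | succ n =>
    have hn := n.lt_succ_self
    refine (h.mul (HasCost.inv (hasCost_ladder (V := V) ?_ ?_ ?_ ?_ ?_ ?_ ?_ ?_ ?_ ?_))).mono
      (N := (8 * (n + 1) + 1) + (8 * n + 1)) (by omega)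
    · exact fun i j hi hj => hd i j (by omega) hj
    · exact fun i hi j hj => hxd i (by omega) j (by omega)
    · exact fun j hj => hzd j (by omega)
    · exact fun i hi => hxd i (by omega) n hn
    · exact fun i hi => (hd n i hn hi).symm
    · exact hzd n hn
    · exact fun i hi => hxV i (by omega)
    · exact fun i hi => hdV i (by omega)
    · exact hzV
    · exact hdV n hn

theorem avoids_compareGate {y : ι} (hx : ∀ i < n, x i ≠ y) (hd : ∀ i < n, d i ≠ y)
    (hz : z ≠ y) (ht : t ≠ y) : Avoids y (compareGate x c d z n t) := by
  cases n with
  | zero => exact (avoids_ladder hx hd hz ht).mul Avoids.one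
  | succ n =>
    exact (avoids_ladder hx hd hz ht).mul (avoids_ladder (fun i hi => hx i (by omega))
      (fun i hi => hd i (by omega)) hz (hd n n.lt_succ_self)).inv

end Ladder

/-- The most significant digit in which the numbers differ decides: there the constant is larger
exactly if its digit is 1. A tie wire equal to 0 makes the inequality strict. -/
theorem comparison_eq_decide {x : ℕ → ι} {z : ι} {s : ι → Bool} (hz : s z = false) {p q n : ℕ}
    (hx : ∀ i < n, s (x i) = p.testBit i) :
    comparison x q.testBit z n s = decide (p % 2 ^ n < q % 2 ^ n) := by
  induction n with
  | zero => simp [comparison, hz, Nat.mod_one]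
  | succ n ih =>
    rw [comparison, ih fun i hi => hx i (hi.trans n.lt_succ_self), hx n n.lt_succ_self,
      Nat.mod_pow_succ, Nat.mod_pow_succ]
    have hp := Nat.mod_lt p (Nat.two_pow_pos n)
    have hq := Nat.mod_lt q (Nat.two_pow_pos n)
    have key : ∀ m : ℕ, m / 2 ^ n % 2 = (m.testBit n).toNat := fun m => by
      rw [Nat.toNat_testBit]
    rw [key, key]
    cases p.testBit n <;> cases q.testBit n <;> simp <;> omega

/-! ### Counters -/

/-- Add the bit `e` to the counter with digits `cnt i, …, cnt (i + n - 1)`, with carries in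
`car`. -/
def increment (cnt car : ℕ → ι) : ℕ → ℕ → ι → Equiv.Perm (ι → Bool)
  | 0, _, _ => 1
  | n + 1, i, e => cnotGate e (cnt i) * tofGate e (cnt i) (car i) *
      increment cnt car n (i + 1) (car i) * tofGate e (cnt i) (car i)

/-- The value of the counter with digits `cnt i, …, cnt (i + n - 1)`. -/
def counterValue (cnt : ℕ → ι) : ℕ → ℕ → (ι → Bool) → ℕ
  | 0, _, _ => 0
  | n + 1, i, s => (s (cnt i)).toNat + 2 * counterValue cnt n (i + 1) s

theorem counterValue_congr {cnt : ℕ → ι} {n i : ℕ} {s s' : ι → Bool}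
    (h : ∀ j ≥ i, j < i + n → s (cnt j) = s' (cnt j)) :
    counterValue cnt n i s = counterValue cnt n i s' := by
  induction n generalizing i with
  | zero => rfl
  | succ n ih =>
    rw [counterValue, counterValue, h i le_rfl (by omega),
      ih fun j hj hj' => h j (by omega) (by omega)]

theorem counterValue_eq_mod {cnt : ℕ → ι} {n i N : ℕ} {s : ι → Bool}
    (h : ∀ j < i + n, s (cnt j) = N.testBit j) :
    counterValue cnt n i s = N / 2 ^ i % 2 ^ n := by
  induction n generalizing i with
  | zero => simp [counterValue, Nat.mod_one]
  | succ n ih =>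
    rw [counterValue, ih fun j hj => h j (by omega), h i (by omega), Nat.toNat_testBit,
      pow_succ' 2 n, Nat.mod_mul, Nat.div_div_eq_div_mul, pow_succ 2 i]

theorem counterValue_succ (cnt : ℕ → ι) (n i : ℕ) (s : ι → Bool) :
    counterValue cnt (n + 1) i s = counterValue cnt n i s + 2 ^ n * (s (cnt (i + n))).toNat := by
  induction n generalizing i with
  | zero => simp [counterValue]
  | succ n ih =>
    rw [counterValue, ih, counterValue, show i + 1 + n = i + (n + 1) by omega, pow_succ]
    ring

theorem counterValue_lt (cnt : ℕ → ι) (n i : ℕ) (s : ι → Bool) :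
    counterValue cnt n i s < 2 ^ n := by
  induction n generalizing i with
  | zero => simp [counterValue]
  | succ n ih =>
    have := ih (i + 1)
    have := Bool.toNat_le (s (cnt i))
    rw [counterValue, pow_succ]
    omega

/-- Turns a threshold test into reading one wire: a counter started at 2^n - v, with v ≤ 2^n, has
its top digit set once v events have been counted. -/
theorem top_eq_decide (cnt : ℕ → ι) (n : ℕ) (s : ι → Bool) :
    s (cnt n) = decide (2 ^ n ≤ counterValue cnt (n + 1) 0 s) := by
  have h := counterValue_lt cnt n 0 s
  rw [counterValue_succ, Nat.zero_add]
  cases s (cnt n) <;> simp [h]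

section Counter

variable {cnt car : ℕ → ι}

/-- A carry is uncomputed from `e` and the old digit, so the digit is updated only after its carry
has been passed on and cleared. The hypothesis `hlt` excludes overflow. -/
theorem increment_spec (hcnt : Function.Injective cnt) (hcar : Function.Injective car)
    (hcc : ∀ i j, cnt i ≠ car j) (n i : ℕ) (e : ι) (he : ∀ j ≥ i, e ≠ cnt j ∧ e ≠ car j)
    (s : ι → Bool) (hs : ∀ j ≥ i, s (car j) = false)
    (hlt : counterValue cnt n i s + (s e).toNat < 2 ^ n) :
    (∀ y, (∀ j ≥ i, y ≠ cnt j) → increment cnt car n i e s y = s y) ∧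
      counterValue cnt n i (increment cnt car n i e s) =
        counterValue cnt n i s + (s e).toNat := by
  induction n generalizing i e s with
  | zero =>
    refine ⟨fun y _ => rfl, ?_⟩
    have h0 : (s e).toNat = 0 := by simpa [counterValue] using hlt
    simp [counterValue, h0]
  | succ n ih =>
    obtain ⟨he1, he2⟩ := he i le_rfl
    have hci := hcc i i
    set s1 := tofGate e (cnt i) (car i) s with hs1
    have e1 : s1 = Function.update s (car i) (s e && s (cnt i)) := by
      rw [hs1, tofGate_apply he2 hci, hs i le_rfl, Bool.false_xor]
    have v1 : counterValue cnt n (i + 1) s1 = counterValue cnt n (i + 1) s :=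
      counterValue_congr fun j _ _ => by rw [e1, Function.update_of_ne (hcc j i)]
    have c1 : s1 (car i) = (s e && s (cnt i)) := by rw [e1, Function.update_self]
    rw [counterValue, pow_succ] at hlt
    obtain ⟨f2, v2⟩ := ih (i + 1) (car i)
      (fun j hj => ⟨(hcc j i).symm, hcar.ne (by omega)⟩) s1
      (fun j hj => by rw [e1, Function.update_of_ne (hcar.ne (by omega)), hs j (by omega)])
      (by
        rw [v1, c1]
        revert hlt
        cases s e <;> cases s (cnt i) <;> simp <;> omega)
    set s2 := increment cnt car n (i + 1) (car i) s1 with hs2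
    have k1 : s2 e = s e := by
      rw [f2 e fun j hj => (he j (by omega)).1, e1, Function.update_of_ne he2]
    have k2 : s2 (cnt i) = s (cnt i) := by
      rw [f2 (cnt i) fun j hj => hcnt.ne (by omega), e1, Function.update_of_ne hci]
    have k3 : s2 (car i) = (s e && s (cnt i)) := by
      rw [f2 (car i) fun j hj => (hcc j i).symm, c1]
    have e4 : increment cnt car (n + 1) i e s =
        Function.update (Function.update s2 (car i) false) (cnt i) (s (cnt i) ^^ s e) := by
      rw [increment, Equiv.Perm.mul_apply, Equiv.Perm.mul_apply, Equiv.Perm.mul_apply, ← hs1,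
        ← hs2, tofGate_apply he2 hci, k1, k2, k3, Bool.xor_self, cnotGate_apply he1,
        Function.update_of_ne hci, k2, Function.update_of_ne he2, k1]
    constructor
    · intro y hy
      rw [e4, Function.update_of_ne (hy i le_rfl)]
      by_cases hyc : y = car i
      · rw [hyc, Function.update_self, hs i le_rfl]
      · rw [Function.update_of_ne hyc, f2 y fun j hj => hy j (by omega), e1,
          Function.update_of_ne hyc]
    · have v4 : counterValue cnt n (i + 1) (increment cnt car (n + 1) i e s) =
          counterValue cnt n (i + 1) s2 := counterValue_congr fun j hj _ => by
        rw [e4, Function.update_of_ne (hcnt.ne (by omega)), Function.update_of_ne (hcc j i)]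
      rw [counterValue, v4, v2, v1, c1, e4, Function.update_self, counterValue]
      cases s e <;> cases s (cnt i) <;> simp <;> omega

theorem hasCost_increment {V : Set ι} (hcar : Function.Injective car)
    (hcc : ∀ i j, cnt i ≠ car j) (n i : ℕ) (e : ι) (he : ∀ j ≥ i, e ≠ cnt j ∧ e ≠ car j)
    (heV : e ∈ V) (hcntV : ∀ j < i + n, cnt j ∈ V) (hcarV : ∀ j < i + n, car j ∈ V) :
    HasCost V (increment cnt car n i e) (3 * n) := by
  induction n generalizing i e with
  | zero => exact HasCost.one
  | succ n ih =>
    have h1 := hasCost_tofGate heV (hcntV i (by omega)) (hcarV i (by omega)) (he i le_rfl).1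
      (he i le_rfl).2 (hcc i i)
    have h2 := hasCost_cnotGate heV (hcntV i (by omega)) (he i le_rfl).1
    have h3 := ih (i + 1) (car i) (fun j hj => ⟨(hcc j i).symm, hcar.ne (by omega)⟩)
      (hcarV i (by omega)) (fun j hj => hcntV j (by omega)) fun j hj => hcarV j (by omega)
    exact (((h2.mul h1).mul h3).mul h1).mono (by omega)

theorem avoids_increment {y : ι} (hcnt : ∀ i, cnt i ≠ y) (hcar : ∀ i, car i ≠ y) (n i : ℕ) {e : ι}
    (he : e ≠ y) : Avoids y (increment cnt car n i e) := by
  induction n generalizing i e with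
  | zero => exact Avoids.one
  | succ n ih =>
    have h := Avoids.tofGate he (hcnt i) (hcar i)
    exact (((Avoids.cnotGate he (hcnt i)).mul h).mul (ih (i + 1) (hcar i))).mul h

end Counter

/-! ### Rotations -/

/-- The controlled swap. -/
def fredkinGate (g a b : ι) : Equiv.Perm (ι → Bool) := cnotGate b a * tofGate g a b * cnotGate b a

theorem fredkinGate_apply {g a b : ι} (hab : a ≠ b) (hga : g ≠ a) (hgb : g ≠ b) (s : ι → Bool)
    (y : ι) : fredkinGate g a b s y =
      if s g then (if y = a then s b else if y = b then s a else s y) else s y := by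
  rw [fredkinGate, Equiv.Perm.mul_apply, Equiv.Perm.mul_apply, cnotGate_apply hab.symm,
    tofGate_apply hgb hab, cnotGate_apply hab.symm]
  by_cases ha : y = a
  · subst ha
    simp only [Function.update_self, Function.update_of_ne hab, Function.update_of_ne hab.symm,
      Function.update_of_ne hga]
    cases s g <;> cases s y <;> cases s b <;> simp
  · by_cases hb : y = b
    · subst hb
      simp only [Function.update_self, Function.update_of_ne hab.symm, Function.update_of_ne hga]
      cases s g <;> cases s y <;> cases s a <;> simp [ha]
    · simp [ha, hb]

theorem hasCost_fredkinGate {V : Set ι} {g a b : ι} (hab : a ≠ b) (hga : g ≠ a) (hgb : g ≠ b)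
    (hg : g ∈ V) (ha : a ∈ V) (hb : b ∈ V) : HasCost V (fredkinGate g a b) 3 :=
  ((hasCost_cnotGate hb ha hab.symm).mul (hasCost_tofGate hg ha hb hga hgb hab)).mul
    (hasCost_cnotGate hb ha hab.symm)

/-- Swap the wires `x i` and `x (i + 1)` for `i = 0, …, n - 1`, controlled by `g i`. -/
def rotation (g x : ℕ → ι) (n : ℕ) : Equiv.Perm (ι → Bool) :=
  seqProd (fun i => fredkinGate (g i) (x i) (x (i + 1))) n

/-- From the `k`-th swap on all swaps are active. Each carries the original value of `x k` one place
further and moves the value it meets one place back. -/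
theorem rotation_spec {g x : ℕ → ι} (hx : Function.Injective x) (hgx : ∀ i j, g i ≠ x j) {n k : ℕ}
    {s : ι → Bool} (hs : ∀ r < n, s (g r) = decide (k ≤ r)) :
    (∀ y, (∀ r ≤ n, y ≠ x r) → rotation g x n s y = s y) ∧
      ∀ r ≤ n, rotation g x n s (x r) =
        if r < k then s (x r) else if r < n then s (x (r + 1)) else s (x k) := by
  induction n with
  | zero =>
    refine ⟨fun y _ => rfl, fun r hr => ?_⟩
    obtain rfl : r = 0 := by omega
    rcases Nat.eq_zero_or_pos k with rfl | hk
    · rfl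
    · rw [if_pos hk]; rfl
  | succ n ih =>
    obtain ⟨ih1, ih2⟩ := ih fun r hr => hs r (by omega)
    have hg : rotation g x n s (g n) = decide (k ≤ n) := by
      rw [ih1 _ fun r _ => hgx n r, hs n n.lt_succ_self]
    have hlast : rotation g x n s (x (n + 1)) = s (x (n + 1)) :=
      ih1 _ fun r hr => hx.ne (by omega)
    have hstep : ∀ y, rotation g x (n + 1) s y = if k ≤ n then
        (if y = x n then s (x (n + 1)) else if y = x (n + 1) then rotation g x n s (x n)
          else rotation g x n s y) else rotation g x n s y := fun y => by
      change fredkinGate (g n) (x n) (x (n + 1)) (rotation g x n s) y = _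
      rw [fredkinGate_apply (hx.ne (by omega)) (hgx _ _) (hgx _ _), hg, hlast]
      simp only [decide_eq_true_eq]
    constructor
    · intro y hy
      rw [hstep, if_neg (hy n (by omega)), if_neg (hy (n + 1) le_rfl),
        ih1 y fun r hr => hy r (by omega)]
      split_ifs <;> rfl
    · intro r hr
      rw [hstep]
      simp only [hx.eq_iff]
      rcases lt_trichotomy r n with h | rfl | h
      · rw [if_neg h.ne, if_neg (show ¬r = n + 1 by omega), ih2 r h.le, if_pos h,
          if_pos (show r < n + 1 by omega), ite_self]
      · rw [if_pos rfl, ih2 r le_rfl, if_neg (lt_irrefl r), if_pos r.lt_succ_self]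
        by_cases hk : k ≤ r
        · rw [if_pos hk, if_neg (show ¬r < k by omega)]
        · rw [if_neg hk, if_pos (show r < k by omega), if_pos (show r < k by omega)]
      · obtain rfl : r = n + 1 := by omega
        rw [if_neg (show ¬n + 1 = n by omega), if_pos rfl, hlast, ih2 n le_rfl,
          if_neg (lt_irrefl n), if_neg (lt_irrefl _)]
        by_cases hk : k ≤ n
        · rw [if_pos hk, if_neg (show ¬n < k by omega), if_neg (show ¬n + 1 < k by omega)]
        · rw [if_neg hk]
          by_cases hk' : n + 1 < k
          · rw [if_pos hk']
          · rw [if_neg hk', show k = n + 1 by omega]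

theorem hasCost_rotation {V : Set ι} {g x : ℕ → ι} (hx : Function.Injective x)
    (hgx : ∀ i j, g i ≠ x j) {n : ℕ} (hg : ∀ i < n, g i ∈ V) (hxV : ∀ i ≤ n, x i ∈ V) :
    HasCost V (rotation g x n) (n * 3) :=
  HasCost.seqProd fun i hi => hasCost_fredkinGate (hx.ne (by omega)) (hgx _ _) (hgx _ _) (hg i hi)
    (hxV i hi.le) (hxV _ hi)

end Subroutines

/-! ### Pointers -/

/-- In an increasing list the entries below `c` form an initial segment. The default value `d ≥ c`
plays the part of infinity past the end of the list. -/
theorem getD_lt_iff_lt_countP {l : List ℕ} (hl : l.Pairwise (· < ·)) {c d : ℕ} (hcd : c ≤ d)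
    (k : ℕ) : l.getD k d < c ↔ k < l.countP (· < c) := by
  induction l generalizing k with
  | nil => simpa using hcd
  | cons a l ih =>
    obtain ⟨ha, hl⟩ := List.pairwise_cons.1 hl
    by_cases hac : a < c
    · rw [List.countP_cons_of_pos (by simpa using hac)]
      cases k with
      | zero => simpa using hac
      | succ k => simpa using ih hl k
    · have h0 : l.countP (· < c) = 0 := by
        rw [List.countP_eq_zero]
        intro x hx
        have := ha x hx
        simp only [decide_eq_true_eq]
        omega
      rw [List.countP_cons_of_neg (by simpa using hac), h0]
      cases k with
      | zero => simpa using hac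
      | succ k =>
        have := ih hl k
        rw [h0] at this
        simpa using this

/-- The number of ones of `b` at positions smaller than `c`. -/
def onesBelow {M : ℕ} (b : Fin M → Bool) (c : ℕ) : ℕ :=
  (Finset.univ.filter fun j => b j = true ∧ j.val < c).card

section Pointer

variable {M : ℕ}

theorem lt_two_pow_pointerBits (M : ℕ) : M < 2 ^ pointerBits M :=
  Nat.le_pow_clog Nat.one_lt_two (M + 1)

theorem le_noFermion (M : ℕ) : M ≤ noFermion M := by
  have := lt_two_pow_pointerBits M
  rw [noFermion]
  omega

/-- Replaces the sorted list of positions by counting; everything later about pointers is derived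
from this equivalence. The bound on `c` guarantees that the placeholder is never smaller than `c`.
-/
theorem pointer_lt_iff (b : Fin M → Bool) (k : ℕ) {c : ℕ} (hc : c ≤ noFermion M) :
    pointer b k < c ↔ k < onesBelow b c := by
  set s := Finset.univ.filter fun j => b j = true with hs
  have hp : ((s.sort (· ≤ ·)).map Fin.val).Pairwise (· < ·) := by
    rw [List.pairwise_map]
    exact (Finset.sortedLT_sort s).pairwise
  have hcount : (s.sort (· ≤ ·)).countP ((fun x => decide (x < c)) ∘ Fin.val) =
      (s.filter fun j => j.val < c).card := by
    rw [Finset.card_def, Finset.filter_val, ← Multiset.countP_eq_card_filter]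
    conv_rhs => rw [← Finset.sort_eq s (· ≤ ·)]
    exact (Multiset.coe_countP _ _).symm
  rw [pointer, getD_lt_iff_lt_countP hp hc, onesBelow, List.countP_map, hcount, hs,
    Finset.filter_filter]

theorem pointer_le (b : Fin M → Bool) (k : ℕ) : pointer b k ≤ noFermion M := by
  by_contra h
  set l := ((Finset.univ.filter fun j => b j = true).sort (· ≤ ·)).map Fin.val with hl
  have hk : pointer b k = l.getD k (noFermion M) := rfl
  by_cases hlen : k < l.length
  · rw [hk, List.getD_eq_getElem _ _ hlen] at h
    simp only [hl, List.getElem_map] at h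
    have := le_noFermion M
    omega
  · rw [hk, List.getD_eq_default _ _ (by omega)] at h
    exact h le_rfl

/-- A number at most `noFermion M` is determined by the thresholds up to `noFermion M` that exceed
it, so identities between pointers reduce to counts of ones. -/
theorem pointer_eq_iff (b b' : Fin M → Bool) (k k' : ℕ) :
    pointer b k = pointer b' k' ↔
      ∀ c ≤ noFermion M, k < onesBelow b c ↔ k' < onesBelow b' c := by
  constructor
  · intro h c hc
    rw [← pointer_lt_iff b k hc, h, pointer_lt_iff b' k' hc]
  · intro h
    have h' : ∀ c ≤ noFermion M, pointer b k < c ↔ pointer b' k' < c := fun c hc => by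
      rw [pointer_lt_iff b k hc, h c hc, pointer_lt_iff b' k' hc]
    apply le_antisymm
    · by_contra hlt
      have := (h' (pointer b k) (pointer_le b k)).2 (by omega)
      omega
    · by_contra hlt
      have := (h' (pointer b' k') (pointer_le b' k')).1 (by omega)
      omega

theorem onesBelow_mono (b : Fin M → Bool) {c c' : ℕ} (h : c ≤ c') :
    onesBelow b c ≤ onesBelow b c' :=
  Finset.card_le_card fun j hj => by
    simp only [Finset.mem_filter, Finset.mem_univ, true_and] at hj ⊢
    exact ⟨hj.1, by omega⟩

theorem onesBelow_le (b : Fin M → Bool) (c : ℕ) : onesBelow b c ≤ hammingWeight b :=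
  Finset.card_le_card fun j hj => by
    simp only [Finset.mem_filter, Finset.mem_univ, true_and] at hj ⊢
    exact hj.1

theorem onesBelow_zero (b : Fin M → Bool) : onesBelow b 0 = 0 := by simp [onesBelow]

theorem onesBelow_succ (b : Fin M → Bool) (j : Fin M) :
    onesBelow b (j + 1) = onesBelow b j + (b j).toNat := by
  have h : (Finset.univ.filter fun i => b i = true ∧ i.val < j + 1) =
      (Finset.univ.filter fun i => b i = true ∧ i.val < j) ∪
        if b j = true then {j} else ∅ := by
    ext i
    simp only [Finset.mem_filter, Finset.mem_univ, true_and, Finset.mem_union]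
    by_cases hij : i = j
    · subst hij
      cases h : b i <;> simp
    · have : i.val ≠ j.val := fun h => hij (Fin.ext h)
      split_ifs <;> simp [hij] <;> omega
  rw [onesBelow, h, Finset.card_union_of_disjoint]
  · cases h : b j <;> simp [onesBelow]
  · split_ifs <;> simp

/-- Only deletion is analysed, here and below; insertion is obtained by running a deletion
backwards. -/
theorem onesBelow_bitFlip (b : Fin M → Bool) (j : Fin M) (hj : b j = true) (c : ℕ) :
    onesBelow (bitFlip j b) c = if c ≤ j then onesBelow b c else onesBelow b c - 1 := by
  have h : (Finset.univ.filter fun i => bitFlip j b i = true ∧ i.val < c) =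
      (Finset.univ.filter fun i => b i = true ∧ i.val < c).erase j := by
    ext i
    simp only [Finset.mem_filter, Finset.mem_univ, true_and, Finset.mem_erase]
    by_cases hij : i = j
    · subst hij
      simp [bitFlip, hj]
    · simp [bitFlip, hij]
  rw [onesBelow, h]
  split_ifs with hc
  · rw [Finset.erase_eq_of_notMem]
    · rfl
    · simp [hc]
  · rw [Finset.card_erase_of_mem]
    · rfl
    · simpa [hj] using hc

theorem bitFlip_bitFlip (b : Fin M → Bool) (j : Fin M) : bitFlip j (bitFlip j b) = b := by
  simp [bitFlip]

theorem bitFlip_apply_self (b : Fin M → Bool) (j : Fin M) : bitFlip j b j = !(b j) := by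
  simp [bitFlip]

theorem sgnRank_eq (b : Fin M → Bool) (j : Fin M) :
    sgnRank j b = (-1) ^ onesBelow b (j + 1) := by
  rw [sgnRank, Finset.prod_pow_eq_pow_sum, onesBelow]
  congr 1
  rw [Finset.card_filter, ← Finset.sum_filter_add_sum_filter_not Finset.univ (fun i => i ≤ j)]
  have h1 : (Finset.univ.filter fun i => i ≤ j) = Finset.Iic j := by
    ext; simp
  rw [h1, Finset.sum_eq_zero (s := Finset.univ.filter fun i => ¬i ≤ j), Nat.add_zero]
  · refine Finset.sum_congr rfl fun i hi => ?_
    have hij : i ≤ j := Finset.mem_Iic.1 hi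
    have : i.val < j + 1 := Nat.lt_succ_of_le hij
    cases b i <;> simp [this]
  · intro i hi
    have hi : ¬i ≤ j := by simpa using hi
    have : ¬i.val < j + 1 := fun h => hi (Nat.le_of_lt_succ h)
    simp [this]

/-! ### The pointers after deleting an occupied position -/

variable {F : ℕ} {b : Fin M → Bool} {j : Fin M}

theorem onesBelow_lt_of_apply (hb : hammingWeight b ≤ F) (hj : b j = true) : onesBelow b j < F := by
  have h1 := onesBelow_succ b j
  have h2 := onesBelow_le b (j + 1)
  rw [hj] at h1
  simp at h1
  omega

theorem le_onesBelow_of_lt (hj : b j = true) {c : ℕ} (hc : j < c) :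
    onesBelow b j + 1 ≤ onesBelow b c := by
  have h1 := onesBelow_succ b j
  rw [hj] at h1
  have := onesBelow_mono b (c := j + 1) (c' := c) hc
  simpa [h1] using this

theorem pointer_onesBelow (hj : b j = true) : pointer b (onesBelow b j) = j := by
  have hM := le_noFermion M
  have hjM := j.isLt
  apply le_antisymm
  · have := (pointer_lt_iff b (onesBelow b j) (c := j + 1) (by omega)).2
      (le_onesBelow_of_lt hj (Nat.lt_succ_self _))
    omega
  · by_contra h
    have := (pointer_lt_iff b (onesBelow b j) (c := j) (by omega)).1 (by omega)
    omega

theorem pointer_bitFlip_of_lt (hj : b j = true) {i : ℕ} (hi : i < onesBelow b j) :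
    pointer (bitFlip j b) i = pointer b i := by
  rw [pointer_eq_iff]
  intro c _
  rw [onesBelow_bitFlip b j hj]
  split_ifs with h
  · rfl
  · have := le_onesBelow_of_lt hj (c := c) (by omega)
    omega

theorem pointer_bitFlip_of_le (hj : b j = true) {i : ℕ} (hi : onesBelow b j ≤ i) :
    pointer (bitFlip j b) i = pointer b (i + 1) := by
  rw [pointer_eq_iff]
  intro c _
  rw [onesBelow_bitFlip b j hj]
  split_ifs with h
  · have := onesBelow_mono b h
    omega
  · have := le_onesBelow_of_lt hj (c := c) (by omega)
    omega

theorem pointer_of_le {k : ℕ} (h : hammingWeight b ≤ k) : pointer b k = noFermion M := by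
  have := onesBelow_le b (noFermion M)
  have := (pointer_lt_iff b k le_rfl).not.2 (by omega)
  have := pointer_le b k
  omega

theorem hammingWeight_bitFlip (hj : b j = true) :
    hammingWeight (bitFlip j b) + 1 = hammingWeight b := by
  have hw : ∀ b' : Fin M → Bool, hammingWeight b' = onesBelow b' M := fun b' => by
    rw [hammingWeight, onesBelow]
    congr 1
    ext i
    simp
  rw [hw, hw, onesBelow_bitFlip b j hj, if_neg (by simp)]
  have := le_onesBelow_of_lt hj j.isLt
  omega

end Pointer

/-! ### Stars and bars -/

/-- The positions of the bars in a string of stars and bars. -/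
theorem intercalate_replicate (n : ℕ) (r : ℕ → ℕ) :
    (List.intercalate [false]
      (List.ofFn fun v : Fin (n + 1) => List.replicate (r v) true)).length =
        n + ∑ i ∈ Finset.range (n + 1), r i ∧
    ∀ q < n + ∑ i ∈ Finset.range (n + 1), r i,
      ((List.intercalate [false]
        (List.ofFn fun v : Fin (n + 1) => List.replicate (r v) true)).getD q false = false ↔
          ∃ v < n, q = v + ∑ i ∈ Finset.range (v + 1), r i) := by
  induction n generalizing r with
  | zero =>
    simp +contextual
  | succ n ih =>
    -- The first block and its bar are split off; the remaining string has the multiplicities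
    -- shifted by one.
    obtain ⟨ih1, ih2⟩ := ih fun i => r (i + 1)
    have hlist : List.intercalate [false]
        (List.ofFn fun v : Fin (n + 1 + 1) => List.replicate (r v) true) =
        List.replicate (r 0) true ++ ([false] ++ List.intercalate [false]
          (List.ofFn fun v : Fin (n + 1) => List.replicate (r (v + 1)) true)) := by
      rw [List.ofFn_succ, List.ofFn_succ, List.intercalate_cons_cons, List.append_assoc]
      conv_rhs => rw [List.ofFn_succ]
      rfl
    rw [hlist]
    have hsum : ∀ m, ∑ i ∈ Finset.range (m + 1), r i =
        (∑ i ∈ Finset.range m, r (i + 1)) + r 0 := fun m => Finset.sum_range_succ' r m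
    constructor
    · rw [List.length_append, List.length_append, ih1, hsum, List.length_replicate,
        List.length_singleton]
      omega
    · intro q hq
      rw [hsum] at hq
      rcases lt_trichotomy q (r 0) with h | h | h
      · rw [List.getD_append _ _ _ _ (by simpa using h), List.getD_replicate _ h]
        simp only [Bool.true_eq_false, false_iff, not_exists, not_and]
        intro v _ hv
        rw [hsum] at hv
        omega
      · subst h
        rw [List.getD_append_right _ _ _ _ (by simp)]
        simp only [List.length_replicate, Nat.sub_self, List.cons_append, List.getD_cons_zero,
          true_iff]
        exact ⟨0, by omega, by simp⟩
      · obtain ⟨m, rfl⟩ : ∃ m, q = m + 1 + r 0 := ⟨q - 1 - r 0, by omega⟩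
        rw [List.getD_append_right _ _ _ _ (by simp)]
        simp only [List.length_replicate, List.singleton_append, Nat.add_sub_cancel,
          List.getD_cons_succ]
        rw [ih2 m (by omega)]
        constructor
        · rintro ⟨v, hv, h'⟩
          exact ⟨v + 1, by omega, by rw [hsum]; omega⟩
        · rintro ⟨v, hv, h'⟩
          rw [hsum] at h'
          cases v with
          | zero => simp at h'
          | succ v => exact ⟨v, by omega, by omega⟩

/-- The number of zeros among the first `q` of the bits `σ 0, …, σ (S - 1)`. -/
def zerosBelow (σ : ℕ → Bool) (S : ℕ) : ℕ → ℕ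
  | 0 => 0
  | q + 1 => zerosBelow σ S q + if q < S ∧ σ q = false then 1 else 0

/-- For 1 ≤ v ≤ n the v-th bar stands at position v - 1 + α v, so v bars have been seen exactly if
this position is below q. For v = n + 1 both sides fail, because n + 1 + F exceeds q. -/
theorem le_zerosBelow_iff {σ : ℕ → Bool} {α : ℕ → ℕ} {n F : ℕ} (hα : Monotone α) (h0 : α 0 = 0)
    (hF : α (n + 1) = F)
    (hσ : ∀ q < F + n, σ q = false ↔ ∃ v < n, q = v + α (v + 1)) {q v : ℕ} (hq : q ≤ F + n)
    (hv : v ≤ n + 1) : v ≤ zerosBelow σ (F + n) q ↔ v + α v ≤ q := by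
  induction q generalizing v with
  | zero =>
    rw [zerosBelow]
    constructor
    · intro h
      obtain rfl : v = 0 := by omega
      omega
    · omega
  | succ q ih =>
    have ih' := fun v hv => ih (v := v) (by omega) hv
    rw [zerosBelow]
    cases h : σ q
    · rw [if_pos ⟨by omega, rfl⟩]
      obtain ⟨u, hu, rfl⟩ := (hσ q (by omega)).1 h
      have h1 := ih' u (by omega)
      have h2 := ih' (u + 1) (by omega)
      have h3 := hα (Nat.le_succ u)
      rw [Nat.succ_eq_add_one] at h3
      constructor
      · intro h4
        have := hα (show v ≤ u + 1 by omega)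
        omega
      · intro h4
        by_contra h5
        have := hα (show u + 1 ≤ v by omega)
        omega
    · rw [if_neg (by simp), Nat.add_zero, ih' v hv]
      constructor
      · omega
      · intro h1
        by_contra h2
        cases v with
        | zero => omega
        | succ v =>
          rcases Nat.lt_or_ge v n with hvn | hvn
          · have := (hσ q (by omega)).2 ⟨v, hvn, by omega⟩
            simp [h] at this
          · obtain rfl : v = n := by omega
            omega

section Stars

variable {M F : ℕ}

theorem msbBits_le_pointerBits (hF : F < M) : msbBits F ≤ pointerBits M :=
  Nat.clog_mono_right 2 (by omega)

theorem two_pow_msbBits_mul (hF : F < M) :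
    2 ^ msbBits F * 2 ^ lsbBits M F = 2 ^ pointerBits M := by
  rw [← pow_add, lsbBits, Nat.add_sub_cancel' (msbBits_le_pointerBits hF)]

/-- The number of bars. -/
def numBars (F : ℕ) : ℕ := 2 ^ msbBits F - 1

theorem numBars_add_one (F : ℕ) : numBars F + 1 = 2 ^ msbBits F := by
  have := Nat.two_pow_pos (msbBits F)
  rw [numBars]
  omega

/-- Makes `pointer_lt_iff` available at every block boundary v · 2^w except the last one, 2^L. -/
theorem mul_le_noFermion (hF : F < M) {v : ℕ} (hv : v ≤ numBars F) :
    v * 2 ^ lsbBits M F ≤ noFermion M := by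
  have h1 : (v + 1) * 2 ^ lsbBits M F ≤ 2 ^ pointerBits M := by
    rw [← two_pow_msbBits_mul hF, ← numBars_add_one]
    exact Nat.mul_le_mul_right _ (by omega)
  have := Nat.two_pow_pos (lsbBits M F)
  rw [Nat.succ_mul] at h1
  rw [noFermion]
  omega

/-- The number of the `F` pointers whose most significant bits have a value smaller than `v`. -/
def starsBelow (F : ℕ) (b : Fin M → Bool) (v : ℕ) : ℕ :=
  if v ≤ numBars F then onesBelow b (v * 2 ^ lsbBits M F) else F

variable {b : Fin M → Bool}

theorem starsBelow_mono (hb : hammingWeight b ≤ F) : Monotone (starsBelow F b) := by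
  intro v v' h
  rw [starsBelow, starsBelow]
  split_ifs with h1 h2
  · exact onesBelow_mono b (Nat.mul_le_mul_right _ h)
  · exact (onesBelow_le b _).trans hb
  · omega
  · rfl

theorem starsBelow_zero : starsBelow F b 0 = 0 := by
  rw [starsBelow, if_pos (Nat.zero_le _), Nat.zero_mul, onesBelow_zero]

/-- At the last boundary all F pointers count. Here the placeholders, which counting ones would
miss, belong to the final block; this is the reason for the case distinction in `starsBelow`. -/
theorem starsBelow_last : starsBelow F b (numBars F + 1) = F := by
  rw [starsBelow, if_neg (by omega)]

theorem pointer_div_lt_iff (hF : F < M) {v k : ℕ} (hv : v ≤ numBars F + 1) (hk : k < F) :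
    pointer b k / 2 ^ lsbBits M F < v ↔ k < starsBelow F b v := by
  rw [Nat.div_lt_iff_lt_mul (Nat.two_pow_pos _), starsBelow]
  split_ifs with h
  · exact pointer_lt_iff b k (mul_le_noFermion hF h)
  · obtain rfl : v = numBars F + 1 := by omega
    rw [numBars_add_one, two_pow_msbBits_mul hF]
    have := pointer_le b k
    have := Nat.two_pow_pos (pointerBits M)
    rw [noFermion] at *
    omega

theorem sum_msbCount (hF : F < M) (hb : hammingWeight b ≤ F) {v : ℕ} (hv : v ≤ numBars F + 1) :
    ∑ i ∈ Finset.range v, msbCount F b i = starsBelow F b v := by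
  have h1 : ∑ i ∈ Finset.range v, msbCount F b i =
      (Finset.univ.filter fun k : Fin F => pointer b k / 2 ^ lsbBits M F < v).card := by
    rw [Finset.card_eq_sum_card_fiberwise (f := fun k : Fin F => pointer b k / 2 ^ lsbBits M F)
      (t := Finset.range v) (fun k hk => by simpa using hk)]
    refine Finset.sum_congr rfl fun i hi => ?_
    rw [msbCount]
    congr 1
    ext k
    have := Finset.mem_range.1 hi
    simp only [Finset.mem_filter, Finset.mem_univ, true_and]
    constructor
    · rintro rfl
      exact ⟨this, rfl⟩
    · exact fun h => h.2
  have h2 : (Finset.univ.filter fun k : Fin F => pointer b k / 2 ^ lsbBits M F < v) =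
      Finset.univ.filter fun k : Fin F => k.val < starsBelow F b v := by
    ext k
    simp only [Finset.mem_filter, Finset.mem_univ, true_and]
    exact pointer_div_lt_iff hF hv k.isLt
  have h3 : starsBelow F b v ≤ F := by
    have := starsBelow_mono hb hv
    rwa [starsBelow_last] at this
  rw [h1, h2, Fin.card_filter_val_lt, Nat.min_eq_right h3]

/-- The bits of the string of stars and bars. -/
def starBit (F : ℕ) (b : Fin M → Bool) (q : ℕ) : Bool := (msbString F b).getD q false

theorem starBit_spec (hF : F < M) (hb : hammingWeight b ≤ F) :
    (msbString F b).length = F + numBars F ∧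
    ∀ q < F + numBars F, starBit F b q = false ↔
      ∃ v < numBars F, q = v + starsBelow F b (v + 1) := by
  have h := intercalate_replicate (numBars F) (msbCount F b)
  rw [sum_msbCount hF hb le_rfl, starsBelow_last, Nat.add_comm (numBars F) F] at h
  have hs : msbString F b = List.intercalate [false]
      (List.ofFn fun v : Fin (numBars F + 1) => List.replicate (msbCount F b v) true) := by
    rw [msbString]
    congr 1
    rw [numBars_add_one]
  rw [← hs] at h
  refine ⟨h.1, fun q hq => ?_⟩
  rw [starBit, h.2 q hq]
  refine exists_congr fun v => and_congr_right fun hv => ?_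
  rw [sum_msbCount hF hb (by omega)]

theorem starBit_of_le (hF : F < M) (hb : hammingWeight b ≤ F) {q : ℕ} (hq : F + numBars F ≤ q) :
    starBit F b q = false :=
  List.getD_eq_default _ _ (by rwa [(starBit_spec hF hb).1])

/-- The v-th bar has v - 1 bars and `starsBelow F b v` stars in front of it, so it lies among the
first v + k places exactly if at most k stars precede it. This says that star k, counted from 0,
comes after it. -/
theorem le_zerosBelow_starBit_iff (hF : F < M) (hb : hammingWeight b ≤ F) {k v : ℕ} (hk : k < F)
    (hv : v ≤ numBars F + 1) :
    v ≤ zerosBelow (starBit F b) (F + numBars F) (v + k) ↔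
      ¬pointer b k / 2 ^ lsbBits M F < v := by
  rw [le_zerosBelow_iff (starsBelow_mono hb) starsBelow_zero starsBelow_last
    (starBit_spec hF hb).2 (by omega) hv, pointer_div_lt_iff hF hv hk]
  omega

/-! ### The stars and bars after deleting an occupied position -/

variable {j : Fin M}

theorem starsBelow_bitFlip (hj : b j = true) {v : ℕ} (hv : v ≤ numBars F) :
    starsBelow F (bitFlip j b) v =
      if v ≤ j / 2 ^ lsbBits M F then starsBelow F b v else starsBelow F b v - 1 := by
  rw [starsBelow, starsBelow, if_pos hv, if_pos hv, onesBelow_bitFlip b j hj]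
  exact if_congr (Nat.le_div_iff_mul_le (Nat.two_pow_pos _)).symm rfl rfl

/-- The deleted position is the star at place u + `onesBelow b j`, where u is the value of its most
significant bits. Everything after it moves one place to the left, and the place freed at the end
receives the star of a new placeholder, whose most significant bits are all ones. -/
theorem starBit_bitFlip (hF : F < M) (hb : hammingWeight b ≤ F) (hj : b j = true) :
    (∀ q < j / 2 ^ lsbBits M F + onesBelow b j, starBit F (bitFlip j b) q = starBit F b q) ∧
    (∀ q, j / 2 ^ lsbBits M F + onesBelow b j ≤ q → q + 1 < F + numBars F →
      starBit F (bitFlip j b) q = starBit F b (q + 1)) ∧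
    (∀ q, q + 1 = F + numBars F → starBit F (bitFlip j b) q = true) ∧
    starBit F b (j / 2 ^ lsbBits M F + onesBelow b j) = true ∧
    j / 2 ^ lsbBits M F ≤ numBars F := by
  set u := j.val / 2 ^ lsbBits M F with hu
  have hwt := hammingWeight_bitFlip hj
  have hb' : hammingWeight (bitFlip j b) ≤ F := by omega
  have hs := (starBit_spec hF hb).2
  have hs' := (starBit_spec hF hb').2
  have hk := onesBelow_lt_of_apply hb hj
  have hw := Nat.two_pow_pos (lsbBits M F)
  have hun : u ≤ numBars F := by
    have : u < numBars F + 1 := by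
      rw [hu, numBars_add_one, Nat.div_lt_iff_lt_mul hw, two_pow_msbBits_mul hF]
      exact j.isLt.trans (lt_two_pow_pointerBits M)
    omega
  -- The bars bounding blocks up to u stand before the deleted star and do not move; the later ones
  -- stand behind it and lose one preceding star.
  have hlow : ∀ v ≤ u, starsBelow F b v ≤ onesBelow b j := fun v hv => by
    rw [starsBelow, if_pos (by omega)]
    exact onesBelow_mono b ((Nat.le_div_iff_mul_le hw).1 hv)
  have hhigh : ∀ v, u < v → v ≤ numBars F → onesBelow b j + 1 ≤ starsBelow F b v :=
    fun v hv hvn => by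
      rw [starsBelow, if_pos hvn]
      exact le_onesBelow_of_lt hj ((Nat.div_lt_iff_lt_mul hw).1 hv)
  have hflip := fun v hv => starsBelow_bitFlip (F := F) hj (v := v) hv
  rw [← hu] at hflip
  have hbool : ∀ {x y : Bool}, (x = false ↔ y = false) → x = y := by decide
  refine ⟨fun q hq => hbool ?_, fun q hq hq1 => hbool ?_, fun q hq => ?_, ?_, hun⟩
  · rw [hs q (by omega), hs' q (by omega)]
    refine exists_congr fun v => and_congr_right fun hv => ?_
    rw [hflip _ (by omega)]
    split_ifs with h
    · rfl
    · have := hhigh (v + 1) (by omega) (by omega)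
      omega
  · rw [hs (q + 1) (by omega), hs' q (by omega)]
    refine exists_congr fun v => and_congr_right fun hv => ?_
    rw [hflip _ (by omega)]
    split_ifs with h
    · have := hlow (v + 1) h
      omega
    · have := hhigh (v + 1) (by omega) (by omega)
      omega
  · by_contra h
    obtain ⟨v, hv, hqv⟩ := (hs' q (by omega)).1 (by simpa using h)
    have h1 : starsBelow F (bitFlip j b) (v + 1) ≤ hammingWeight (bitFlip j b) := by
      rw [starsBelow, if_pos (by omega)]
      exact onesBelow_le _ _
    omega
  · by_contra h
    obtain ⟨v, hv, hqv⟩ := (hs (u + onesBelow b j) (by omega)).1 (by simpa using h)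
    rcases Nat.lt_or_ge u (v + 1) with h1 | h1
    · have := hhigh (v + 1) h1 (by omega)
      omega
    · have := hlow (v + 1) h1
      omega

end Stars

/-! ### The bits of the encoded string -/

theorem succinctList_getD_of_lt {M F : ℕ} (b : Fin M → Bool) {q : ℕ} (hq : q < F * lsbBits M F) :
    (succinctList F b).getD q false =
      (pointer b (q / lsbBits M F)).testBit (q % lsbBits M F) := by
  have hw : 0 < lsbBits M F := Nat.pos_of_ne_zero fun h => by simp [h] at hq
  have h := List.ofFn_mul (m := F) (n := lsbBits M F) fun i : Fin (F * lsbBits M F) =>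
    (pointer b (i / lsbBits M F)).testBit (i % lsbBits M F)
  have hflat : (List.ofFn fun i : Fin F => lsbRegister M F (pointer b i)).flatten =
      List.ofFn fun i : Fin (F * lsbBits M F) =>
        (pointer b (i / lsbBits M F)).testBit (i % lsbBits M F) := by
    rw [h]
    congr 2
    funext i
    rw [lsbRegister]
    congr 1
    funext k
    have h1 : (i.val * lsbBits M F + k) / lsbBits M F = i := by
      rw [Nat.add_comm, Nat.add_mul_div_right _ _ hw, Nat.div_eq_of_lt k.isLt, Nat.zero_add]
    have h2 : (i.val * lsbBits M F + k) % lsbBits M F = k := by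
      rw [Nat.add_comm, Nat.add_mul_mod_self_right, Nat.mod_eq_of_lt k.isLt]
    simp only [h1, h2]
  rw [succinctList, hflat, List.getD_append _ _ _ _ (by simpa using hq),
    List.getD_eq_getElem _ _ (by simpa using hq), List.getElem_ofFn]

theorem succinctList_getD_add {M F : ℕ} (b : Fin M → Bool) (q : ℕ) :
    (succinctList F b).getD (F * lsbBits M F + q) false = starBit F b q := by
  have hlen : (List.ofFn fun i : Fin F => lsbRegister M F (pointer b i)).flatten.length =
      F * lsbBits M F := by
    simp [List.length_flatten, List.map_ofFn, Function.comp_def, lsbRegister]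
  rw [succinctList, List.getD_append_right _ _ _ _ (by omega), hlen, Nat.add_sub_cancel_left,
    starBit]

/-! ### The wires of the data structure -/

/-- The wires: the registers, the string of stars and bars, and several kinds of ancillas. -/
inductive Wire : Type
  | reg (k i : ℕ)
  | slot (q : ℕ)
  | lt (k : ℕ)
  | tie (k : ℕ)
  | move (k : ℕ)
  | count (k : ℕ)
  | carry (k : ℕ)
  | work (k : ℕ)
  deriving DecidableEq

namespace Wire

theorem lt_injective : Function.Injective lt := fun _ _ h => by injection h

theorem tie_injective : Function.Injective tie := fun _ _ h => by injection h

theorem move_injective : Function.Injective move := fun _ _ h => by injection h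

theorem count_injective : Function.Injective count := fun _ _ h => by injection h

theorem carry_injective : Function.Injective carry := fun _ _ h => by injection h

end Wire

open Wire

/-- The wires that are present. -/
def validWires (M F : ℕ) : Set Wire := fun x => match x with
  | reg k i => k < F ∧ i < lsbBits M F
  | slot q => q < F + numBars F
  | lt k => k < 5 * F
  | tie k => k < 5 * F
  | move k => k < 5 * F
  | count k => k < 5 * F
  | carry k => k < 5 * F
  | work k => k < 5 * F

section Gates

variable {M F : ℕ}

/-- Ensures that the G + 1 digits and carries of the counter fit into O(F) ancillas. -/
theorem msbBits_lt (hF : 0 < F) : msbBits F < F :=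
  have h1 : Nat.clog 2 F ≤ F - 1 :=
    Nat.clog_le_of_le_pow (by have := Nat.lt_two_pow_self (n := F - 1); omega)
  lt_of_le_of_lt h1 (by omega)

theorem numBars_le (hF : 0 < F) : numBars F + 1 ≤ 2 * F := by
  rw [numBars_add_one, msbBits]
  rcases Nat.lt_or_ge 1 F with h | h
  · have h1 := Nat.pow_pred_clog_lt_self Nat.one_lt_two h
    have h2 := Nat.clog_pos Nat.one_lt_two h
    obtain ⟨m, hm⟩ : ∃ m, Nat.clog 2 F = m + 1 := ⟨Nat.clog 2 F - 1, by omega⟩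
    rw [hm] at h1 ⊢
    rw [pow_succ]
    simp at h1
    omega
  · obtain rfl : F = 1 := by omega
    simp

/-! ### Comparing the most significant bits -/

/-- Count a zero at position `q` of the string of stars and bars. -/
def countStep (F q : ℕ) : Equiv.Perm (Wire → Bool) :=
  if q < F + numBars F then
    notGate (slot q) * increment count carry (msbBits F + 1) 0 (slot q) * notGate (slot q)
  else 1

/-- Count the zeros among the first `q` positions of the string of stars and bars, starting from
`2 ^ G - v`. -/
def countTo (F v q : ℕ) : Equiv.Perm (Wire → Bool) :=
  seqProd (countStep F) q * flipGates count (2 ^ msbBits F - v).testBit (msbBits F + 1)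

/-- Add to `flag k` whether the most significant bits of the `k`-th pointer are smaller
than `v`. -/
def msbGate (F v : ℕ) (flag : ℕ → Wire) : Equiv.Perm (Wire → Bool) :=
  seqProd (fun k => (countTo F v (v + k))⁻¹ * xorAt (flag k) (fun s => !(s (count (msbBits F)))) *
    countTo F v (v + k)) F

theorem zerosBelow_starBit_le {b : Fin M → Bool} (hF : F < M) (hb : hammingWeight b ≤ F) {q : ℕ}
    (hq : q ≤ F + numBars F) : zerosBelow (starBit F b) (F + numBars F) q ≤ numBars F := by
  by_contra h
  have := (le_zerosBelow_iff (starsBelow_mono hb) starsBelow_zero starsBelow_last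
    (starBit_spec hF hb).2 hq le_rfl).1 (show numBars F + 1 ≤ _ by omega)
  rw [starsBelow_last] at this
  omega

theorem countTo_spec {b : Fin M → Bool} (hF : F < M) (hb : hammingWeight b ≤ F) (v : ℕ)
    {s : Wire → Bool} (hstar : ∀ q < F + numBars F, s (slot q) = starBit F b q)
    (hcount : ∀ i, s (count i) = false) (hcarry : ∀ i, s (carry i) = false) (q : ℕ) :
    (∀ y, (∀ i, y ≠ count i) → countTo F v q s y = s y) ∧
      counterValue count (msbBits F + 1) 0 (countTo F v q s) =
        2 ^ msbBits F - v + zerosBelow (starBit F b) (F + numBars F) q := by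
  induction q with
  | zero =>
    have h : countTo F v 0 s =
        addTo count (2 ^ msbBits F - v).testBit (msbBits F + 1) s := by
      rw [countTo, seqProd, one_mul, flipGates_apply]
    refine ⟨fun y hy => by rw [h, addTo_apply_of_forall_ne fun i _ => hy i], ?_⟩
    rw [h, counterValue_eq_mod (N := 2 ^ msbBits F - v) fun j hj => by
      rw [addTo_apply count_injective (by omega), hcount, Bool.false_xor], pow_zero, Nat.div_one,
      Nat.mod_eq_of_lt, zerosBelow, Nat.add_zero]
    have := Nat.two_pow_pos (msbBits F)
    rw [pow_succ]
    omega
  | succ q ih =>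
    obtain ⟨ih1, ih2⟩ := ih
    have hstep : countTo F v (q + 1) s = countStep F q (countTo F v q s) := rfl
    rw [hstep, countStep, zerosBelow]
    set s1 := countTo F v q s with hs1
    by_cases hq : q < F + numBars F
    · have hle := zerosBelow_starBit_le hF hb (show q + 1 ≤ F + numBars F by omega)
      rw [zerosBelow] at hle
      have hσ : s1 (slot q) = starBit F b q := by
        rw [ih1 _ (by simp), hstar q hq]
      set s2 := notGate (slot q) s1 with hs2
      have e2 : s2 = Function.update s1 (slot q) (!starBit F b q) := by
        rw [hs2, notGate_apply, hσ]
      have v2 : counterValue count (msbBits F + 1) 0 s2 =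
          counterValue count (msbBits F + 1) 0 s1 := counterValue_congr fun j _ _ => by
        rw [e2, Function.update_of_ne (by simp)]
      have hbit : s2 (slot q) = !starBit F b q := by rw [e2, Function.update_self]
      obtain ⟨f3, v3⟩ := increment_spec count_injective carry_injective (by simp) (msbBits F + 1) 0
        (slot q) (by simp) s2 (fun j _ => by
          rw [e2, Function.update_of_ne (by simp), ih1 _ (by simp), hcarry])
        (by
          rw [v2, ih2, hbit, pow_succ, ← numBars_add_one]
          revert hle
          simp only [hq, true_and]
          cases starBit F b q <;> simp <;> omega)
      set s3 := increment count carry (msbBits F + 1) 0 (slot q) s2 with hs3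
      have e4 : (notGate (slot q) * increment count carry (msbBits F + 1) 0 (slot q) *
          notGate (slot q)) s1 = Function.update s3 (slot q) (starBit F b q) := by
        rw [Equiv.Perm.mul_apply, Equiv.Perm.mul_apply, ← hs2, ← hs3, notGate_apply,
          f3 (slot q) (by simp), hbit, Bool.not_not]
      rw [if_pos hq, e4]
      constructor
      · intro y hy
        by_cases hyq : y = slot q
        · rw [hyq, Function.update_self, hstar q hq]
        · rw [Function.update_of_ne hyq, f3 y fun j _ => hy j, e2, Function.update_of_ne hyq,
            ih1 y hy]
      · rw [counterValue_congr (s' := s3) fun j _ _ => Function.update_of_ne (by simp) _ _, v3,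
          v2, ih2, hbit]
        simp only [hq, true_and]
        cases starBit F b q <;> simp <;> omega
    · rw [if_neg hq, if_neg (by simp [hq])]
      exact ⟨ih1, ih2⟩

theorem avoids_countStep {y : Wire} (hs : ∀ q, slot q ≠ y) (hc : ∀ i, count i ≠ y)
    (hr : ∀ i, carry i ≠ y) (q : ℕ) : Avoids y (countStep F q) := by
  rw [countStep]
  split_ifs
  · exact ((Avoids.notGate (hs q)).mul (avoids_increment hc hr _ _ (hs q))).mul
      (Avoids.notGate (hs q))
  · exact Avoids.one

theorem avoids_countTo {y : Wire} (hs : ∀ q, slot q ≠ y) (hc : ∀ i, count i ≠ y)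
    (hr : ∀ i, carry i ≠ y) (v q : ℕ) : Avoids y (countTo F v q) :=
  (Avoids.seqProd fun i _ => avoids_countStep hs hc hr i).mul (avoids_flipGates (fun i _ => hc i) _)

theorem msbGate_apply {b : Fin M → Bool} (hF : F < M) (hb : hammingWeight b ≤ F) {v : ℕ}
    (hv : v ≤ numBars F + 1) {flag : ℕ → Wire}
    (hs : ∀ q k, slot q ≠ flag k) (hc : ∀ i k, count i ≠ flag k) (hr : ∀ i k, carry i ≠ flag k)
    {s : Wire → Bool} (hstar : ∀ q < F + numBars F, s (slot q) = starBit F b q)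
    (hcount : ∀ i, s (count i) = false) (hcarry : ∀ i, s (carry i) = false) :
    msbGate F v flag s =
      addTo flag (fun k => decide (pointer b k / 2 ^ lsbBits M F < v)) F s := by
  refine seqProd_eq_addTo fun k hk s' hs' => ?_
  rw [(avoids_countTo (fun q => hs q k) (fun i => hc i k) (fun i => hr i k) v (v + k)).conj_xorAt_apply
    fun s b => by rw [Function.update_of_ne (hc _ _)]]
  congr 2
  obtain ⟨-, h2⟩ := countTo_spec hF hb v
    (s := s') (fun q hq => by rw [hs' _ fun k _ => hs q k, hstar q hq])
    (fun i => by rw [hs' _ fun k _ => hc i k, hcount i])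
    (fun i => by rw [hs' _ fun k _ => hr i k, hcarry i]) (v + k)
  -- Since v ≤ 2^G, the top digit says 2^G ≤ 2^G - v + zeros, that is, at least v zeros among the
  -- first v + k places. Its negation is the flag wanted.
  rw [top_eq_decide count (msbBits F) (countTo F v (v + k) s'), h2, ← decide_not]
  congr 1
  rw [eq_iff_iff, ← not_iff_not, ← le_zerosBelow_starBit_iff hF hb hk hv, not_not,
    ← numBars_add_one]
  omega

/-- A bound for the gate count of `msbGate`. -/
theorem hasCost_msbGate (hF : 0 < F) {v : ℕ} (hv : v ≤ numBars F + 1) {flag : ℕ → Wire}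
    (hc : ∀ i k, count i ≠ flag k) (hflag : ∀ k < F, flag k ∈ validWires M F) :
    HasCost (validWires M F) (msbGate F v flag) (F * (20 * msbBits F + 34)) := by
  set G := msbBits F with hG
  have hGF : G < F := msbBits_lt hF
  have hcnt : ∀ j < 0 + (G + 1), count j ∈ validWires M F := fun j hj => show j < 5 * F by omega
  have hcar : ∀ j < 0 + (G + 1), carry j ∈ validWires M F := fun j hj => show j < 5 * F by omega
  have hstep : ∀ q, HasCost (validWires M F) (countStep F q) (3 * G + 5) := fun q => by
    rw [countStep]
    split_ifs with hq
    · have h1 : HasCost (validWires M F) (notGate (slot q)) 1 := hasCost_notGate hq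
      refine ((h1.mul (hasCost_increment carry_injective (by simp) (G + 1) 0 (slot q) (by simp) hq
        hcnt hcar)).mul h1).mono (by omega)
    · exact HasCost.one.mono (by omega)
  have hto : ∀ q, HasCost (validWires M F) (countTo F v q) (q * (3 * G + 5) + (G + 1)) := fun q =>
    (HasCost.seqProd fun i _ => hstep i).mul
      (hasCost_flipGates (fun i hi => hcnt i (by omega)) _)
  -- Uncomputing the count up to v + n and recomputing it up to v + n + 1 amounts to a single
  -- counting step. The product telescopes, and the sweep over all pointers counts each place once
  -- instead of once per pointer. The leading factor `countTo` keeps the induction in telescoped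
  -- form.
  have hW : ∀ n ≤ F, HasCost (validWires M F) (countTo F v (v + n) * seqProd (fun k =>
      (countTo F v (v + k))⁻¹ * xorAt (flag k) (fun s => !(s (count (msbBits F)))) *
        countTo F v (v + k)) n) ((v + n) * (3 * G + 5) + (G + 1) + 2 * n) := by
    intro n
    induction n with
    | zero => exact fun _ => hto v
    | succ n ih =>
      intro hn
      have hx : HasCost (validWires M F)
          (xorAt (flag n) (fun s => !(s (count (msbBits F))))) 2 := by
        have := (hasCost_notGate (hflag n hn)).mul
          (hasCost_cnotGate (hcnt G (by omega)) (hflag n hn) (hc G n))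
        rw [notGate, cnotGate, xorAt_mul_xorAt (ignoresWire_const _ _)
          (ignoresWire_coord (hc G n))] at this
        simpa only [Bool.xor_true] using this
      have := ((hstep (v + n)).mul hx).mul (ih (by omega))
      refine HasCost.mono (N := 3 * G + 5 + 2 + ((v + n) * (3 * G + 5) + (G + 1) + 2 * n)) ?_ ?_
      · convert this using 1
        rw [seqProd]
        change countStep F (v + n) * countTo F v (v + n) * _ = _
        group
      · rw [show v + (n + 1) = v + n + 1 by omega, Nat.succ_mul (v + n)]
        omega
  have h := (hto (v + F)).inv.mul (hW F le_rfl)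
  rw [← mul_assoc, inv_mul_cancel, one_mul] at h
  refine h.mono ?_
  -- As v ≤ 2F, a full sweep has at most 3F steps. One forward and one backward sweep, two
  -- initialisations of G + 1 gates and 2F flag gates give the bound.
  have := numBars_le hF
  have h3 : (v + F) * (3 * G + 5) ≤ 3 * F * (3 * G + 5) := Nat.mul_le_mul_right _ (by omega)
  nlinarith

/-! ### Comparing the least significant bits -/

/-- Compute into `work 3` whether the least significant bits of the `k`-th pointer are smaller than
those of `c`. The two halves of the register are borrowed in turn. -/
def lsbCompare (w c k : ℕ) : Equiv.Perm (Wire → Bool) :=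
  compareGate (fun i => reg k (w / 2 + i)) (fun i => c.testBit (w / 2 + i))
      (fun i => if w / 2 + i + 1 = w then work 4 else reg k i) (work 2) (w - w / 2) (work 3) *
    compareGate (fun i => reg k i) c.testBit (fun i => reg k (w / 2 + i)) (work 1) (w / 2) (work 2)

/-- Comparing the high digits with ties broken by the result for the low digits compares the whole
number; this splits a register into two halves. -/
theorem comparison_add {ι : Type*} {x : ℕ → ι} {c : ℕ → Bool} {z z' : ι} {h n : ℕ}
    {s s' : ι → Bool} (hz : s' z' = comparison x c z h s)
    (hx : ∀ i < n, s' (x (h + i)) = s (x (h + i))) :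
    comparison (fun i => x (h + i)) (fun i => c (h + i)) z' n s' = comparison x c z (h + n) s := by
  induction n with
  | zero => exact hz
  | succ n ih =>
    rw [comparison, ih fun i hi => hx i (by omega), hx n n.lt_succ_self, ← Nat.add_assoc,
      comparison]

/-- The result for the lower half, in `work 2`, breaks the ties of the upper half. The upper half
may be one digit longer than the lower, so its last borrowed wire is `work 4`. -/
theorem lsbCompare_apply {w c k p : ℕ} {s : Wire → Bool} (h1 : s (work 1) = false)
    (h2 : s (work 2) = false) (h3 : s (work 3) = false)
    (hp : ∀ i < w, s (reg k i) = p.testBit i) :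
    lsbCompare w c k s (work 3) = decide (p % 2 ^ w < c % 2 ^ w) ∧
      ∀ j, lsbCompare w c k s (tie j) = s (tie j) := by
  have e : lsbCompare w c k s = _ := Equiv.Perm.mul_apply _ _ s
  rw [compareGate_apply (by intros; split_ifs <;> simp <;> omega)
    (by intros; split_ifs <;> simp <;> omega) (by intros; split_ifs <;> simp) (by simp)
    (by intros; split_ifs <;> simp) (by simp), compareGate_apply (by intros; simp; omega)
    (by intros; simp; omega) (by simp) (by simp) (by simp) (by simp)] at e
  refine ⟨?_, fun j => by rw [e]; simp⟩
  rw [e, Function.update_self, Function.update_of_ne (by simp), h3, Bool.false_xor,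
    comparison_add (x := fun i => reg k i) (z := work 1) (s := s)
      (by rw [Function.update_self, h2, Bool.false_xor])
      (fun i _ => Function.update_of_ne (by simp) _ _), comparison_eq_decide h1 (p := p)]
  · rw [show w / 2 + (w - w / 2) = w by omega]
  · exact fun i hi => hp i (by omega)

theorem avoids_lsbCompare (w c k j : ℕ) : Avoids (lt j) (lsbCompare w c k) :=
  (avoids_compareGate (by simp) (by intros; split_ifs <;> simp) (by simp) (by simp)).mul
    (avoids_compareGate (by simp) (by simp) (by simp) (by simp))

theorem hasCost_lsbCompare (c : ℕ) {k : ℕ} (hk : k < F) :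
    HasCost (validWires M F) (lsbCompare (lsbBits M F) c k) (16 * lsbBits M F + 2) := by
  have hw : ∀ i < 5, work i ∈ validWires M F := fun i hi => show i < 5 * F by omega
  have hr : ∀ i < lsbBits M F, reg k i ∈ validWires M F := fun i hi => ⟨hk, hi⟩
  refine ((hasCost_compareGate ?_ ?_ ?_ ?_ ?_ ?_ ?_ ?_ ?_ ?_).mul
    (hasCost_compareGate ?_ ?_ ?_ ?_ ?_ ?_ ?_ ?_ ?_ ?_)).mono
    (N := (16 * (lsbBits M F - lsbBits M F / 2) + 1) + (16 * (lsbBits M F / 2) + 1)) (by omega)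
  · intros; split_ifs <;> simp <;> omega
  · intros; split_ifs <;> simp <;> omega
  · intros; split_ifs <;> simp
  · simp
  · intros; split_ifs <;> simp
  · simp
  · exact fun i hi => hr _ (by omega)
  · intro i hi
    split_ifs
    exacts [hw 4 (by omega), hr i (by omega)]
  · exact hw 2 (by omega)
  · exact hw 3 (by omega)
  · intros; simp; omega
  · intros; simp; omega
  · simp
  · simp
  · simp
  · simp
  · exact fun i hi => hr i (by omega)
  · exact fun i hi => hr _ (by omega)
  · exact hw 1 (by omega)
  · exact hw 2 (by omega)

/-- Add to `lt k`, if `tie k` is set, whether the least significant bits of the `k`-th pointer are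
smaller than those of `c`. -/
def lsbGate (M F c : ℕ) : Equiv.Perm (Wire → Bool) :=
  seqProd (fun k => (lsbCompare (lsbBits M F) c k)⁻¹ * tofGate (tie k) (work 3) (lt k) *
    lsbCompare (lsbBits M F) c k) F

theorem lsbGate_apply {c : ℕ} {p : ℕ → ℕ} {s : Wire → Bool} (h1 : s (work 1) = false)
    (h2 : s (work 2) = false) (h3 : s (work 3) = false)
    (hp : ∀ k < F, ∀ i < lsbBits M F, s (reg k i) = (p k).testBit i) :
    lsbGate M F c s = addTo lt (fun k => s (tie k) &&
      decide (p k % 2 ^ lsbBits M F < c % 2 ^ lsbBits M F)) F s := by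
  refine seqProd_eq_addTo fun k hk s' hs' => ?_
  rw [tofGate, (avoids_lsbCompare (lsbBits M F) c k k).conj_xorAt_apply
    ((ignoresWire_coord (by simp)).map₂ (ignoresWire_coord (by simp)) and)]
  obtain ⟨e1, e2⟩ := lsbCompare_apply (w := lsbBits M F) (c := c) (k := k) (p := p k) (s := s')
    (by rw [hs' _ (by simp), h1]) (by rw [hs' _ (by simp), h2]) (by rw [hs' _ (by simp), h3])
    (fun i hi => by rw [hs' _ (by simp), hp k hk i hi])
  rw [e1, e2, hs' (tie k) (by simp)]

theorem hasCost_lsbGate (hF : 0 < F) (c : ℕ) :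
    HasCost (validWires M F) (lsbGate M F c) (F * (32 * lsbBits M F + 5)) := by
  refine HasCost.seqProd fun k hk => ?_
  have h := hasCost_lsbCompare (M := M) c hk
  exact ((h.inv.mul (hasCost_tofGate (show k < 5 * F by omega) (show 3 < 5 * F by omega)
    (show k < 5 * F by omega) (by simp) (by simp) (by simp))).mul h).mono (by omega)

/-! ### Comparing the pointers -/

/-- Add to `lt k` whether the `k`-th pointer is smaller than `c`. -/
def lessGate (M F c : ℕ) : Equiv.Perm (Wire → Bool) :=
  msbGate F (c / 2 ^ lsbBits M F + 1) tie * msbGate F (c / 2 ^ lsbBits M F) tie * lsbGate M F c *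
    msbGate F (c / 2 ^ lsbBits M F + 1) tie * msbGate F (c / 2 ^ lsbBits M F) tie *
      msbGate F (c / 2 ^ lsbBits M F) lt

/-- The state of all wires: the encoding of `b`, the bits `U` in the wires `lt`, the bit `m` in
`work 0`, and zeros. -/
def memory (F : ℕ) (b : Fin M → Bool) (U : ℕ → Bool) (m : Bool) : Wire → Bool
  | reg k i => decide (k < F ∧ i < lsbBits M F) && (pointer b k).testBit i
  | slot q => starBit F b q
  | lt k => U k
  | tie _ => false
  | move _ => false
  | count _ => false
  | carry _ => false
  | work k => decide (k = 0) && m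

theorem addTo_lt (v : ℕ → Bool) (n : ℕ) (s : Wire → Bool) (k : ℕ) :
    addTo lt v n s (lt k) = (s (lt k) ^^ (decide (k < n) && v k)) := by
  by_cases h : k < n
  · simp [addTo_apply lt_injective h, h]
  · rw [addTo_apply_of_forall_ne fun i hi => by simp; omega]
    simp [h]

theorem addTo_tie (v : ℕ → Bool) (n : ℕ) (s : Wire → Bool) (k : ℕ) :
    addTo tie v n s (tie k) = (s (tie k) ^^ (decide (k < n) && v k)) := by
  by_cases h : k < n
  · simp [addTo_apply tie_injective h, h]
  · rw [addTo_apply_of_forall_ne fun i hi => by simp; omega]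
    simp [h]

theorem addTo_lt_of_ne {v : ℕ → Bool} {n : ℕ} {s : Wire → Bool} {y : Wire} (h : ∀ k, y ≠ lt k) :
    addTo lt v n s y = s y :=
  addTo_apply_of_forall_ne fun i _ => h i

theorem addTo_tie_of_ne {v : ℕ → Bool} {n : ℕ} {s : Wire → Bool} {y : Wire}
    (h : ∀ k, y ≠ tie k) : addTo tie v n s y = s y :=
  addTo_apply_of_forall_ne fun i _ => h i

theorem div_le_numBars (hF : F < M) {c : ℕ} (hc : c ≤ noFermion M) :
    c / 2 ^ lsbBits M F ≤ numBars F := by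
  have h : c / 2 ^ lsbBits M F < numBars F + 1 := by
    rw [numBars_add_one, Nat.div_lt_iff_lt_mul (Nat.two_pow_pos _), two_pow_msbBits_mul hF]
    have := Nat.two_pow_pos (pointerBits M)
    rw [noFermion] at hc
    omega
  omega

/-- With v the high part of `c`, a pointer is smaller than `c` if its high part is below v, or
equals v with smaller low bits. Equality with v is the exclusive or of the tests against v and v +
1, collected in `tie`. The two cases are disjoint, so they may be added into `lt`; repeating both
tests clears `tie`. -/
theorem lessGate_memory {b : Fin M → Bool} (hF : F < M) (hb : hammingWeight b ≤ F) {c : ℕ}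
    (hc : c ≤ noFermion M) (U : ℕ → Bool) (m : Bool) :
    lessGate M F c (memory F b U m) =
      memory F b (fun k => U k ^^ (decide (k < F) && decide (pointer b k < c))) m := by
  have hv := div_le_numBars hF hc
  set v := c / 2 ^ lsbBits M F with hvdef
  -- All wires except `lt` and `tie` have their initial values between the stages, which is all that
  -- the specifications of the subroutines require.
  let Clean (s : Wire → Bool) : Prop :=
    ∀ y, (∀ k, y ≠ lt k) → (∀ k, y ≠ tie k) → s y = memory F b U m y
  have c0 : Clean (memory F b U m) := fun _ _ _ => rfl
  have hcl : ∀ {s} (f : ℕ → Bool), Clean s → Clean (addTo lt f F s) := fun f hs y h1 h2 => by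
    rw [addTo_lt_of_ne h1, hs y h1 h2]
  have hct : ∀ {s} (f : ℕ → Bool), Clean s → Clean (addTo tie f F s) := fun f hs y h1 h2 => by
    rw [addTo_tie_of_ne h2, hs y h1 h2]
  have hlt : ∀ {u : ℕ} (_ : u ≤ numBars F + 1) {s : Wire → Bool} (_ : Clean s),
      msbGate F u lt s = _ := fun hu s hs =>
    msbGate_apply hF hb hu (by simp) (by simp) (by simp)
      (fun q _ => hs (slot q) (by simp) (by simp)) (fun i => hs (count i) (by simp) (by simp))
      fun i => hs (carry i) (by simp) (by simp)
  have htie : ∀ {u : ℕ} (_ : u ≤ numBars F + 1) {s : Wire → Bool} (_ : Clean s),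
      msbGate F u tie s = _ := fun hu s hs =>
    msbGate_apply hF hb hu (by simp) (by simp) (by simp)
      (fun q _ => hs (slot q) (by simp) (by simp)) (fun i => hs (count i) (by simp) (by simp))
      fun i => hs (carry i) (by simp) (by simp)
  have hlsb : ∀ {s : Wire → Bool} (_ : Clean s), lsbGate M F c s = _ := fun {s} hs =>
    lsbGate_apply (p := pointer b) (hs (work 1) (by simp) (by simp))
      (hs (work 2) (by simp) (by simp)) (hs (work 3) (by simp) (by simp)) fun k hk i hi => by
        rw [hs (reg k i) (by simp) (by simp), memory, decide_eq_true ⟨hk, hi⟩, Bool.true_and]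
  have hv0 : v ≤ numBars F + 1 := by omega
  have hv1 : v + 1 ≤ numBars F + 1 := by omega
  simp only [lessGate, Equiv.Perm.mul_apply, ← hvdef]
  have c1 := hcl (fun k => decide (pointer b k / 2 ^ lsbBits M F < v)) c0
  have c2 := hct (fun k => decide (pointer b k / 2 ^ lsbBits M F < v)) c1
  have c3 := hct (fun k => decide (pointer b k / 2 ^ lsbBits M F < v + 1)) c2
  have c4 := hcl (fun k => addTo tie (fun k => decide (pointer b k / 2 ^ lsbBits M F < v + 1)) F
    (addTo tie (fun k => decide (pointer b k / 2 ^ lsbBits M F < v)) F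
    (addTo lt (fun k => decide (pointer b k / 2 ^ lsbBits M F < v)) F (memory F b U m))) (tie k) &&
      decide (pointer b k % 2 ^ lsbBits M F < c % 2 ^ lsbBits M F)) c3
  have c5 := hct (fun k => decide (pointer b k / 2 ^ lsbBits M F < v)) c4
  rw [hlt hv0 c0, htie hv0 c1, htie hv1 c2, hlsb c3, htie hv0 c4, htie hv1 c5]
  clear c1 c2 c3 c4 c5 hlt htie hlsb hcl hct c0
  funext y
  cases y with
  | lt k =>
    simp only [addTo_lt, addTo_tie, memory, addTo_tie_of_ne, addTo_lt_of_ne, ne_eq, reduceCtorEq,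
      not_false_eq_true, implies_true]
    by_cases hk : k < F
    · have h1 := Nat.div_add_mod (pointer b k) (2 ^ lsbBits M F)
      have h2 := Nat.div_add_mod c (2 ^ lsbBits M F)
      have h3 := Nat.mod_lt (pointer b k) (Nat.two_pow_pos (lsbBits M F))
      have h4 := Nat.mod_lt c (Nat.two_pow_pos (lsbBits M F))
      rw [← hvdef] at h2
      set x := pointer b k / 2 ^ lsbBits M F
      set W := 2 ^ lsbBits M F
      have key : pointer b k < c ↔ x < v ∨ (x < v + 1 ∧ pointer b k % W < c % W) := by
        rcases lt_trichotomy x v with h | h | h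
        · have : W * (x + 1) ≤ W * v := Nat.mul_le_mul_left _ h
          rw [Nat.mul_succ] at this
          exact ⟨fun _ => Or.inl h, fun _ => by omega⟩
        · rw [h] at h1
          constructor
          · exact fun _ => Or.inr ⟨by omega, by omega⟩
          · rintro (h' | h') <;> omega
        · have : W * (v + 1) ≤ W * x := Nat.mul_le_mul_left _ h
          rw [Nat.mul_succ] at this
          constructor
          · intro; omega
          · rintro (h' | h') <;> omega
      simp only [hk, decide_true, Bool.true_and, key]
      by_cases h5 : x < v
      · have h6 : x < v + 1 := by omega
        simp [h5, h6]
      · simp [h5]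
    · simp [hk]
  | tie k =>
    simp only [addTo_tie, memory, addTo_lt_of_ne, ne_eq, reduceCtorEq,
      not_false_eq_true, implies_true]
    generalize decide (k < F) = A
    generalize decide (pointer b k / 2 ^ lsbBits M F < v) = B
    generalize decide (pointer b k / 2 ^ lsbBits M F < v + 1) = C
    cases A <;> cases B <;> cases C <;> rfl
  | _ =>
    simp only [memory, addTo_tie_of_ne, addTo_lt_of_ne, ne_eq, reduceCtorEq,
      not_false_eq_true, implies_true]


theorem hasCost_lessGate (hF0 : 0 < F) (hF : F < M) {c : ℕ} (hc : c ≤ noFermion M) :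
    HasCost (validWires M F) (lessGate M F c) (F * (132 * pointerBits M + 175)) := by
  have hv := div_le_numBars hF hc
  have h1 : ∀ u ≤ numBars F + 1, HasCost (validWires M F) (msbGate F u tie)
      (F * (20 * msbBits F + 34)) := fun u hu =>
    hasCost_msbGate hF0 hu (by simp) fun k hk => show k < 5 * F by omega
  have h2 : HasCost (validWires M F) (msbGate F (c / 2 ^ lsbBits M F) lt)
      (F * (20 * msbBits F + 34)) :=
    hasCost_msbGate hF0 (by omega) (by simp) fun k hk => show k < 5 * F by omega
  have ha := h1 (c / 2 ^ lsbBits M F) (by omega)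
  have hb := h1 (c / 2 ^ lsbBits M F + 1) (by omega)
  refine (((((hb.mul ha).mul (hasCost_lsbGate hF0 c)).mul hb).mul ha).mul h2).mono ?_
  have hG := msbBits_le_pointerBits hF
  have hw : lsbBits M F ≤ pointerBits M := Nat.sub_le _ _
  calc _ = F * (100 * msbBits F + 32 * lsbBits M F + 175) := by ring
    _ ≤ _ := Nat.mul_le_mul_left _ (by omega)

end Gates

section Queries

variable {M F : ℕ}

/-! ### Parities and membership -/

/-- The parity of the first `n` bits of `U`. -/
def parity (U : ℕ → Bool) : ℕ → Bool
  | 0 => false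
  | n + 1 => parity U n ^^ U n

theorem update_memory_work (b : Fin M → Bool) (U : ℕ → Bool) (m m' : Bool) :
    Function.update (memory F b U m) (work 0) m' = memory F b U m' := by
  funext y
  by_cases h : y = work 0
  · subst h
    simp [memory]
  · rw [Function.update_of_ne h]
    cases y with
    | work k =>
      have hk : k ≠ 0 := fun hk => h (by rw [hk])
      simp [memory, hk]
    | _ => rfl

/-- Add the parity of the wires `lt` to `work 0`. -/
def parityGate (F : ℕ) : Equiv.Perm (Wire → Bool) :=
  seqProd (fun k => cnotGate (lt k) (work 0)) F

theorem parityGate_memory (b : Fin M → Bool) (U : ℕ → Bool) (m : Bool) :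
    parityGate F (memory F b U m) = memory F b U (m ^^ parity U F) := by
  have h := seqProd_apply_of_forall (f := fun k => cnotGate (lt k) (work 0)) (n := F)
    (fun k => memory F b U (m ^^ parity U k)) fun k _ => by
      rw [cnotGate_apply (by simp), update_memory_work]
      simp [memory, parity]
  rw [parityGate]
  simpa [parity] using h

theorem hasCost_parityGate : HasCost (validWires M F) (parityGate F) F := by
  refine (HasCost.seqProd (K := 1) fun k hk => ?_).mono (by omega)
  exact hasCost_cnotGate (show k < 5 * F by omega) (show 0 < 5 * F by omega) (by simp)

/-- The flags that are set form an initial segment of length `onesBelow b c`, which is at most `F`.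
-/
theorem parity_lt {b : Fin M → Bool} (hb : hammingWeight b ≤ F) {c : ℕ} (hc : c ≤ noFermion M) :
    parity (fun k => false ^^ (decide (k < F) && decide (pointer b k < c))) F =
      decide (onesBelow b c % 2 = 1) := by
  have hN := (onesBelow_le b c).trans hb
  suffices ∀ n ≤ F, parity (fun k => false ^^ (decide (k < F) && decide (pointer b k < c))) n =
      decide (min n (onesBelow b c) % 2 = 1) by
    rw [this F le_rfl, Nat.min_eq_right hN]
  intro n
  induction n with
  | zero => simp [parity]
  | succ n ih =>
    intro hn
    rw [parity, ih (by omega)]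
    simp only [pointer_lt_iff b n hc, show n < F by omega, decide_true, Bool.true_and,
      Bool.false_xor]
    by_cases h : n < onesBelow b c
    · rw [Nat.min_eq_left (by omega), Nat.min_eq_left (by omega)]
      simp only [h, decide_true, Bool.xor_true]
      rw [← decide_not]
      congr 1
      rw [eq_iff_iff]
      omega
    · rw [Nat.min_eq_right (by omega), Nat.min_eq_right (by omega)]
      simp [h]

/-- Add to `work 0` the parity of the number of ones at positions smaller than `c`. -/
def countParity (M F c : ℕ) : Equiv.Perm (Wire → Bool) :=
  lessGate M F c * parityGate F * lessGate M F c

theorem countParity_memory {b : Fin M → Bool} (hF : F < M) (hb : hammingWeight b ≤ F) {c : ℕ}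
    (hc : c ≤ noFermion M) (m : Bool) :
    countParity M F c (memory F b (fun _ => false) m) =
      memory F b (fun _ => false) (m ^^ decide (onesBelow b c % 2 = 1)) := by
  rw [countParity, Equiv.Perm.mul_apply, Equiv.Perm.mul_apply, lessGate_memory hF hb hc,
    parityGate_memory, parity_lt hb hc, lessGate_memory hF hb hc]
  congr 1
  funext k
  simp

theorem hasCost_countParity (hF0 : 0 < F) (hF : F < M) {c : ℕ} (hc : c ≤ noFermion M) :
    HasCost (validWires M F) (countParity M F c) (F * (264 * pointerBits M + 351)) := by
  have h := hasCost_lessGate hF0 hF hc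
  exact ((h.mul hasCost_parityGate).mul h).mono (by ring_nf; rfl)

theorem succ_le_noFermion (j : Fin M) : j.val + 1 ≤ noFermion M :=
  le_trans j.isLt (le_noFermion M)

/-- Add the bit at position `j` to `work 0`. -/
def memberGate (M F j : ℕ) : Equiv.Perm (Wire → Bool) :=
  countParity M F (j + 1) * countParity M F j

/-- The numbers of ones below j + 1 and below j differ by the bit at j. -/
theorem memberGate_memory {b : Fin M → Bool} (hF : F < M) (hb : hammingWeight b ≤ F) (j : Fin M)
    (m : Bool) : memberGate M F j (memory F b (fun _ => false) m) =
      memory F b (fun _ => false) (m ^^ b j) := by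
  have hj := succ_le_noFermion j
  rw [memberGate, Equiv.Perm.mul_apply, countParity_memory hF hb (by omega),
    countParity_memory hF hb hj, onesBelow_succ, Bool.xor_assoc]
  congr 2
  rcases Nat.mod_two_eq_zero_or_one (onesBelow b j) with h | h <;> cases b j <;>
    simp [Nat.add_mod, h]

theorem hasCost_memberGate (hF0 : 0 < F) (hF : F < M) (j : Fin M) :
    HasCost (validWires M F) (memberGate M F j) (F * (528 * pointerBits M + 702)) := by
  have hj := succ_le_noFermion j
  exact ((hasCost_countParity hF0 hF hj).mul (hasCost_countParity hF0 hF (by omega))).mono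
    (by ring_nf; rfl)

/-! ### Insertion and deletion by rotations -/

/-- Compute into `move k` the conjunction of `work 0` and the negation of `lt k`. -/
def moveGate (F : ℕ) : Equiv.Perm (Wire → Bool) :=
  seqProd (fun k => xorAt (move k) fun s => s (work 0) ^^ (s (work 0) && s (lt k))) F

theorem moveGate_apply (s : Wire → Bool) :
    moveGate F s = addTo move (fun k => s (work 0) && !(s (lt k))) F s := by
  refine seqProd_eq_addTo fun k _ s' hs' => ?_
  rw [xorAt_apply fun s b => by simp, hs' (work 0) (by simp), hs' (lt k) (by simp)]
  congr 2
  cases s (work 0) <;> cases s (lt k) <;> rfl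

theorem hasCost_moveGate : HasCost (validWires M F) (moveGate F) (F * 2) := by
  refine HasCost.seqProd fun k hk => ?_
  have h1 : work 0 ∈ validWires M F := show 0 < 5 * F by omega
  have h2 : lt k ∈ validWires M F := show k < 5 * F by omega
  have h3 : move k ∈ validWires M F := show k < 5 * F by omega
  have h := (hasCost_tofGate h1 h2 h3 (by simp) (by simp) (by simp)).mul
    (hasCost_cnotGate h1 h3 (by simp))
  rwa [tofGate, cnotGate, xorAt_mul_xorAt
    ((ignoresWire_coord (by simp)).map₂ (ignoresWire_coord (by simp)) and)
    (ignoresWire_coord (by simp))] at h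

theorem addTo_move (v : ℕ → Bool) (n : ℕ) (s : Wire → Bool) (k : ℕ) :
    addTo move v n s (move k) = (s (move k) ^^ (decide (k < n) && v k)) := by
  by_cases h : k < n
  · simp [addTo_apply move_injective h, h]
  · rw [addTo_apply_of_forall_ne fun i hi => by simp; omega]
    simp [h]

theorem addTo_move_of_ne {v : ℕ → Bool} {n : ℕ} {s : Wire → Bool} {y : Wire}
    (h : ∀ k, y ≠ move k) : addTo move v n s y = s y :=
  addTo_apply_of_forall_ne fun i _ => h i

/-- Rotate the registers. -/
def registerRotation (M F : ℕ) : Equiv.Perm (Wire → Bool) :=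
  seqProd (fun i => rotation move (fun k => reg k i) (F - 1)) (lsbBits M F)

/-- Rotate the string of stars and bars from position `v` on. -/
def slotRotation (F v : ℕ) : Equiv.Perm (Wire → Bool) :=
  rotation (fun r => if r < F then move r else work 0) (fun r => slot (v + r))
    (F + numBars F - 1 - v)

theorem reg_left_injective (i : ℕ) : Function.Injective fun k => reg k i :=
  fun _ _ h => by injection h

theorem reg_right_injective (k : ℕ) : Function.Injective (reg k) :=
  fun _ _ h => by injection h

theorem slot_injective (v : ℕ) : Function.Injective fun r => slot (v + r) :=
  fun _ _ h => by
    injection h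
    omega

theorem registerRotation_spec {K : ℕ} {s : Wire → Bool}
    (hs : ∀ r < F - 1, s (move r) = decide (K ≤ r)) :
    (∀ y, (∀ k ≤ F - 1, ∀ i < lsbBits M F, y ≠ reg k i) → registerRotation M F s y = s y) ∧
      ∀ i < lsbBits M F, ∀ r ≤ F - 1, registerRotation M F s (reg r i) =
        if r < K then s (reg r i) else if r < F - 1 then s (reg (r + 1) i) else s (reg K i) := by
  rw [registerRotation]
  generalize lsbBits M F = w
  induction w with
  | zero => exact ⟨fun _ _ => rfl, fun i hi => by omega⟩
  | succ w ih =>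
    obtain ⟨ih1, ih2⟩ := ih
    set s1 := seqProd (fun i => rotation move (fun k => reg k i) (F - 1)) w s with hs1
    obtain ⟨h1, h2⟩ := rotation_spec (g := move) (x := fun k => reg k w) (s := s1) (k := K)
      (n := F - 1) (reg_left_injective w) (by simp) fun r hr => by
        rw [ih1 _ (by simp), hs r hr]
    have h0 : ∀ r, s1 (reg r w) = s (reg r w) := fun r =>
      ih1 _ fun k _ i hi => by
        simp only [ne_eq, reg.injEq, not_and]
        omega
    have e : seqProd (fun i => rotation move (fun k => reg k i) (F - 1)) (w + 1) s =
        rotation move (fun k => reg k w) (F - 1) s1 := rfl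
    rw [e]
    constructor
    · intro y hy
      rw [h1 y fun r hr => hy r hr w w.lt_succ_self,
        ih1 y fun k hk i hi => hy k hk i (by omega)]
    · intro i hi r hr
      rcases Nat.lt_succ_iff_lt_or_eq.1 hi with h | rfl
      · rw [h1 _ fun r' _ => by simp only [ne_eq, reg.injEq, not_and]; omega, ih2 i h r hr]
      · rw [h2 r hr, h0, h0, h0]

theorem rotation_eq_self {ι : Type*} [DecidableEq ι] {g x : ℕ → ι} (hx : Function.Injective x)
    (hgx : ∀ i j, g i ≠ x j) {n : ℕ} {s : ι → Bool} (hs : ∀ r < n, s (g r) = false) :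
    rotation g x n s = s := by
  refine seqProd_apply_of_forall (fun _ => s) fun i hi => ?_
  funext y
  rw [fredkinGate_apply (hx.ne (by omega)) (hgx _ _) (hgx _ _), hs i hi]
  rfl

/-- Move the `k`-th pointer to the end, if `work 0` is set, where `k` is the number of wires `lt`
that are set, and `v` is the value of the most significant bits of this pointer. -/
def rotateGate (M F v : ℕ) : Equiv.Perm (Wire → Bool) :=
  (moveGate F)⁻¹ * (slotRotation F v * registerRotation M F) * moveGate F

theorem slotRotation_control_ne (i j v : ℕ) :
    (if i < F then move i else work 0) ≠ slot (v + j) := by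
  split_ifs <;> simp

/-- With `work 0` unset every swap is inactive. Hence `rotateGate` and its inverse can both be
placed in the flip circuit without further controls. -/
theorem rotateGate_memory_false (b : Fin M → Bool) (U : ℕ → Bool) (v : ℕ) :
    rotateGate M F v (memory F b U false) = memory F b U false := by
  have h0 : moveGate F (memory F b U false) = memory F b U false := by
    rw [moveGate_apply]
    funext y
    cases y with
    | move k => simp [addTo_move, memory]
    | _ => rw [addTo_move_of_ne (by simp)]
  have h1 : registerRotation M F (memory F b U false) = memory F b U false :=
    seqProd_apply_of_forall (fun _ => memory F b U false) fun i _ =>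
      rotation_eq_self (reg_left_injective i) (by simp) fun r _ => rfl
  have h2 : slotRotation F v (memory F b U false) = memory F b U false :=
    rotation_eq_self (slot_injective v) (fun i j => slotRotation_control_ne i j v) fun r _ => by
      split_ifs <;> simp [memory]
  rw [rotateGate, Equiv.Perm.mul_apply, Equiv.Perm.mul_apply, h0, Equiv.Perm.mul_apply, h1, h2,
    Equiv.Perm.inv_eq_iff_eq, h0]

/-- Exchange in the last register the least significant bits of `j` and of the placeholder. -/
def lastGate (M F j : ℕ) : Equiv.Perm (Wire → Bool) :=
  flipGates (reg (F - 1)) (fun i => !(j.testBit i)) (lsbBits M F)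

/-- The wires `lt` after comparing the pointers with `c`. -/
def ltBits (F : ℕ) (b : Fin M → Bool) (c k : ℕ) : Bool :=
  decide (k < F) && decide (pointer b k < c)

/-- With K = `onesBelow b j`, the rotations carry register K and the star at v + K to the end, which
is the effect of deletion on all other pointers. The last register then holds the low bits of j
where the placeholder has ones; `lastGate` flips exactly the zero bits of j. The `move` wires depend
only on `lt` and `work 0`, so they can be cleared afterwards. -/
theorem rotateGate_memory_true {b : Fin M → Bool} (hF : F < M) (hb : hammingWeight b ≤ F)
    {j : Fin M} (hj : b j = true) :
    rotateGate M F (j / 2 ^ lsbBits M F) (memory F b (ltBits F b j) true) =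
      lastGate M F j (memory F (bitFlip j b) (ltBits F b j) true) := by
  obtain ⟨st1, st2, st3, st4, hvn⟩ := starBit_bitFlip hF hb hj
  have hwt := hammingWeight_bitFlip hj
  have hKF := onesBelow_lt_of_apply hb hj
  have hjM := succ_le_noFermion j
  have hpK := pointer_onesBelow hj
  have hplt := fun i (h : i < onesBelow b j) => pointer_bitFlip_of_lt hj h
  have hple := fun i (h : onesBelow b j ≤ i) => pointer_bitFlip_of_le hj h
  have hplast : pointer (bitFlip j b) (F - 1) = noFermion M := pointer_of_le (by omega)
  have hb' : hammingWeight (bitFlip j b) ≤ F := by omega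
  have hU : ∀ k < F, ltBits F b j k = decide (k < onesBelow b j) := fun k hk => by
    rw [ltBits, decide_eq_true hk, Bool.true_and]
    exact decide_eq_decide.2 (pointer_lt_iff b k (by omega))
  set K := onesBelow b j with hK
  set v := j.val / 2 ^ lsbBits M F with hv
  set s0 := memory F b (ltBits F b j) true with hs0
  set X := lastGate M F j (memory F (bitFlip j b) (ltBits F b j) true) with hX
  have hXe : X = addTo (reg (F - 1)) (fun i => !(j.val.testBit i)) (lsbBits M F)
      (memory F (bitFlip j b) (ltBits F b j) true) := flipGates_apply _ _ _ _
  have hXne : ∀ y, (∀ i < lsbBits M F, y ≠ reg (F - 1) i) →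
      X y = memory F (bitFlip j b) (ltBits F b j) true y := fun y hy => by
    rw [hXe, addTo_apply_of_forall_ne hy]
  have hmX : moveGate F X = addTo move (fun k => true && !(ltBits F b j k)) F X := by
    rw [moveGate_apply, hXne (work 0) (by simp)]
    congr 1
    funext k
    rw [hXne (lt k) (by simp)]
    rfl
  have hs1 : moveGate F s0 = addTo move (fun k => true && !(ltBits F b j k)) F s0 :=
    moveGate_apply s0
  rw [rotateGate, Equiv.Perm.mul_apply, Equiv.Perm.mul_apply, Equiv.Perm.inv_eq_iff_eq, hs1, hmX,
    Equiv.Perm.mul_apply]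
  set s1 := addTo move (fun k => true && !(ltBits F b j k)) F s0 with hs1'
  have hmove : ∀ r < F, s1 (move r) = decide (K ≤ r) := fun r hr => by
    rw [hs1', addTo_move, hU r hr, decide_eq_true hr]
    simp [hs0, memory, ← decide_not]
  have hne1 : ∀ y, (∀ k, y ≠ move k) → s1 y = s0 y := fun y hy => addTo_move_of_ne hy
  obtain ⟨r1, r2⟩ := registerRotation_spec (M := M) (F := F) (K := K) (s := s1)
    fun r hr => hmove r (by omega)
  set s2 := registerRotation M F s1 with hs2
  -- The slots outnumber the `move` wires. For r ≥ F one has K < F ≤ r, so the swap is always active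
  -- and `work 0`, which is set, can control it.
  obtain ⟨t1, t2⟩ := rotation_spec (g := fun r => if r < F then move r else work 0)
    (x := fun r => slot (v + r)) (s := s2) (k := K) (n := F + numBars F - 1 - v)
    (slot_injective v) (fun i j => slotRotation_control_ne i j v) fun r hr => by
      split_ifs with h
      · rw [r1 _ (by simp), hmove r h]
      · rw [r1 _ (by simp), hne1 _ (by simp)]
        simp only [hs0, memory, decide_true, Bool.true_and]
        exact (decide_eq_true (by omega)).symm
  have hs3 : slotRotation F v s2 = rotation (fun r => if r < F then move r else work 0)
    (fun r => slot (v + r)) (F + numBars F - 1 - v) s2 := rfl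
  rw [← hs3] at t1 t2
  have hslot : ∀ q, s2 (slot q) = starBit F b q := fun q => by
    rw [r1 _ (by simp), hne1 _ (by simp)]
    rfl
  funext y
  cases y with
  | reg r i =>
    rw [t1 _ (by simp), addTo_move_of_ne (by simp)]
    by_cases hri : r < F ∧ i < lsbBits M F
    · rw [r2 i hri.2 r (by omega), hne1 _ (by simp), hne1 _ (by simp), hne1 _ (by simp)]
      simp only [hs0, memory]
      by_cases hr : r = F - 1
      · subst hr
        rw [if_neg (by omega), if_neg (by omega), decide_eq_true ⟨hKF, hri.2⟩, hpK, hXe,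
          addTo_apply (reg_right_injective _) hri.2, memory, decide_eq_true hri, hplast, noFermion,
          Nat.testBit_two_pow_sub_one, decide_eq_true (lt_of_lt_of_le hri.2 (Nat.sub_le _ _))]
        simp
      · rw [hXne _ fun i' _ => by simp only [ne_eq, reg.injEq, not_and]; omega, memory]
        split_ifs with h1 h2
        · rw [hplt r h1]
        · rw [hple r (by omega), decide_eq_true hri, decide_eq_true ⟨by omega, hri.2⟩]
        · omega
    · rw [r1 _ fun k hk i' hi' => by simp only [ne_eq, reg.injEq, not_and]; omega,
        hne1 _ (by simp), hXne _ fun i' hi' => by simp only [ne_eq, reg.injEq, not_and]; omega]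
      simp [hs0, memory, hri]
  | slot q =>
    rw [addTo_move_of_ne (by simp), hXne _ (by simp), memory]
    by_cases hq : v ≤ q ∧ q < F + numBars F
    · obtain ⟨r, rfl⟩ := Nat.exists_eq_add_of_le hq.1
      rw [t2 r (by omega)]
      simp only [hslot]
      split_ifs with h1 h2
      · rw [st1 _ (by omega)]
      · rw [st2 (v + r) (by omega) (by omega), Nat.add_assoc]
      · rw [st3 (v + r) (by omega), st4]
    · rw [t1 _ fun r hr => by simp only [ne_eq, slot.injEq]; omega, hslot]
      by_cases hq' : q < v
      · rw [st1 q (by omega)]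
      · rw [starBit_of_le hF hb (by omega), starBit_of_le hF hb' (by omega)]
  | move k =>
    rw [t1 _ (by simp), r1 _ (by simp), hs1', addTo_move, addTo_move, hXne _ (by simp)]
    rfl
  | _ =>
    rw [t1 _ (by simp), r1 _ (by simp), hs1', addTo_move_of_ne (by simp),
      addTo_move_of_ne (by simp), hXne _ (by simp)]
    rfl

theorem hasCost_rotateGate (hF0 : 0 < F) (v : ℕ) :
    HasCost (validWires M F) (rotateGate M F v) (F * (3 * lsbBits M F + 13)) := by
  have hreg : HasCost (validWires M F) (registerRotation M F) (lsbBits M F * ((F - 1) * 3)) :=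
    HasCost.seqProd fun i hi => hasCost_rotation (reg_left_injective i) (by simp)
      (fun r hr => show r < 5 * F by omega) fun r hr => ⟨by omega, hi⟩
  have hn := numBars_le hF0
  have hslot : HasCost (validWires M F) (slotRotation F v) (F * 9) := by
    by_cases hv : v ≤ F + numBars F - 1
    · refine (hasCost_rotation (slot_injective v)
        (fun i j => slotRotation_control_ne i j v) (fun r hr => ?_) fun r hr =>
          show v + r < F + numBars F by omega).mono ?_
      · split_ifs with h
        exacts [show r < 5 * F by omega, show 0 < 5 * F by omega]
      · omega
    · rw [slotRotation, Nat.sub_eq_zero_of_le (by omega)]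
      exact HasCost.one.mono (by omega)
  refine ((hasCost_moveGate.inv.mul (hslot.mul hreg)).mul hasCost_moveGate).mono ?_
  have h : lsbBits M F * ((F - 1) * 3) ≤ lsbBits M F * (F * 3) :=
    Nat.mul_le_mul_left _ (by omega)
  calc _ ≤ F * 2 + (F * 9 + lsbBits M F * (F * 3)) + F * 2 := by omega
    _ = _ := by ring

theorem notGate_lastGate_memory (b : Fin M → Bool) (U : ℕ → Bool) (m : Bool) (j : ℕ) :
    notGate (work 0) (lastGate M F j (memory F b U m)) = lastGate M F j (memory F b U !m) := by
  have h : Avoids (work 0) (lastGate M F j) := avoids_flipGates (by simp) _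
  rw [notGate_apply, h.apply_self, ← h, update_memory_work]
  simp [memory]

theorem notGate_memory (b : Fin M → Bool) (U : ℕ → Bool) (m : Bool) :
    notGate (work 0) (memory F b U m) = memory F b U !m := by
  rw [notGate_apply, update_memory_work]
  simp [memory]

/-- Negate the bit at position `j`. -/
def flipGate (M F j : ℕ) : Equiv.Perm (Wire → Bool) :=
  notGate (work 0) * memberGate M F j * lessGate M F j * (notGate (work 0) *
    (rotateGate M F (j / 2 ^ lsbBits M F))⁻¹ * notGate (work 0) * lastGate M F j *
      rotateGate M F (j / 2 ^ lsbBits M F)) * lessGate M F j * memberGate M F j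

theorem lessGate_memory_ltBits {b : Fin M → Bool} (hF : F < M) (hb : hammingWeight b ≤ F) {c : ℕ}
    (hc : c ≤ noFermion M) (m : Bool) :
    lessGate M F c (memory F b (fun _ => false) m) = memory F b (ltBits F b c) m ∧
      lessGate M F c (memory F b (ltBits F b c) m) = memory F b (fun _ => false) m := by
  rw [lessGate_memory hF hb hc, lessGate_memory hF hb hc]
  constructor
  · congr 1
    funext k
    rw [ltBits, Bool.false_xor]
  · congr 1
    funext k
    rw [ltBits, Bool.xor_self]

/-- A flip at j does not change the number of ones below j, so comparing with j again after the flip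
clears the flags. -/
theorem ltBits_bitFlip {b : Fin M → Bool} {j : Fin M} (hj : b j = true) :
    ltBits F (bitFlip j b) j = ltBits F b j := by
  have hjM := succ_le_noFermion j
  funext k
  rw [ltBits, ltBits]
  congr 1
  rw [decide_eq_decide, pointer_lt_iff _ _ (by omega), pointer_lt_iff _ _ (by omega),
    onesBelow_bitFlip b j hj, if_pos le_rfl]

theorem lastGate_lastGate (j : ℕ) (s : Wire → Bool) : lastGate M F j (lastGate M F j s) = s := by
  rw [lastGate, flipGates_apply, flipGates_apply]
  funext y
  by_cases h : ∃ i < lsbBits M F, y = reg (F - 1) i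
  · obtain ⟨i, hi, rfl⟩ := h
    rw [addTo_apply (reg_right_injective _) hi, addTo_apply (reg_right_injective _) hi]
    simp
  · have h' : ∀ i < lsbBits M F, y ≠ reg (F - 1) i := fun i hi he => h ⟨i, hi, he⟩
    rw [addTo_apply_of_forall_ne h', addTo_apply_of_forall_ne h']

/-- If the bit at j is 1, the first rotation and `lastGate` delete j, and the inverse rotation is
switched off by the negated control. If it is 0, the first rotation is idle, and `lastGate` followed
by the inverse rotation undoes the deletion of j from the flipped string. The control still holds
the old bit; `memberGate` adds the new one, which makes it 1, and the final NOT clears it. -/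
theorem flipGate_memory {b : Fin M → Bool} (hF : F < M) (j : Fin M) (hb : hammingWeight b ≤ F)
    (hb' : hammingWeight (bitFlip j b) ≤ F) :
    flipGate M F j (memory F b (fun _ => false) false) =
      memory F (bitFlip j b) (fun _ => false) false := by
  have hjM := succ_le_noFermion j
  obtain ⟨l1, -⟩ := lessGate_memory_ltBits hF hb (c := j) (by omega) (b j)
  obtain ⟨-, l2⟩ := lessGate_memory_ltBits hF hb' (c := j) (by omega) (b j)
  simp only [flipGate, Equiv.Perm.mul_apply]
  rw [memberGate_memory hF hb, Bool.false_xor, l1]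
  suffices h : notGate (work 0) ((rotateGate M F (j / 2 ^ lsbBits M F))⁻¹ (notGate (work 0)
      (lastGate M F j (rotateGate M F (j / 2 ^ lsbBits M F)
        (memory F b (ltBits F b j) (b j)))))) =
      memory F (bitFlip j b) (ltBits F (bitFlip j b) j) (b j) by
    rw [h, l2, memberGate_memory hF hb', bitFlip_apply_self, notGate_memory]
    simp
  cases hj : b j
  · have hj' : bitFlip j b j = true := by rw [bitFlip_apply_self, hj]; rfl
    have key := rotateGate_memory_true hF hb' hj'
    have hlt := ltBits_bitFlip (F := F) hj'
    rw [bitFlip_bitFlip] at key hlt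
    rw [rotateGate_memory_false, notGate_lastGate_memory, hlt, Bool.not_false, ← key,
      Equiv.Perm.inv_eq_iff_eq.2 rfl, notGate_memory, Bool.not_true]
  · rw [rotateGate_memory_true hF hb hj, lastGate_lastGate, notGate_memory, ltBits_bitFlip hj,
      Bool.not_true]
    have key := rotateGate_memory_false (F := F) (bitFlip j b) (ltBits F b j)
      (j.val / 2 ^ lsbBits M F)
    rw [Equiv.Perm.inv_eq_iff_eq.2 key.symm, notGate_memory, Bool.not_false]

theorem hasCost_flipGate (hF0 : 0 < F) (hF : F < M) (j : Fin M) :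
    HasCost (validWires M F) (flipGate M F j) (F * (1327 * pointerBits M + 1784)) := by
  have hjM := succ_le_noFermion j
  have h0 : HasCost (validWires M F) (notGate (work 0)) 1 :=
    hasCost_notGate (show 0 < 5 * F by omega)
  have hm := hasCost_memberGate hF0 hF j
  have hl := hasCost_lessGate hF0 hF (c := j) (by omega)
  have hr := hasCost_rotateGate (M := M) hF0 (j / 2 ^ lsbBits M F)
  have hlast : HasCost (validWires M F) (lastGate M F j) (lsbBits M F) :=
    hasCost_flipGates (V := validWires M F) (x := reg (F - 1))
      (fun i hi => ⟨Nat.sub_lt hF0 one_pos, hi⟩) _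
  refine (((((h0.mul hm).mul hl).mul ((((h0.mul hr.inv).mul h0).mul hlast).mul hr)).mul hl).mul
    hm).mono ?_
  have hw : lsbBits M F ≤ pointerBits M := Nat.sub_le _ _
  have h1 : F * (3 * lsbBits M F + 13) ≤ F * (3 * pointerBits M + 13) :=
    Nat.mul_le_mul_left _ (by omega)
  have h2 : pointerBits M ≤ F * pointerBits M := Nat.le_mul_of_pos_left _ hF0
  nlinarith

end Queries

/-! ### The layout of the wires -/

theorem HasCost.mono_set {ι : Type*} [DecidableEq ι] {V V' : Set ι}
    {π : Equiv.Perm (ι → Bool)} {N : ℕ} (h : HasCost V π N) (hV : V ⊆ V') : HasCost V' π N := by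
  obtain ⟨l, h1, h2, h3⟩ := h
  refine ⟨l, fun g hg => ?_, h2, h3⟩
  cases h1 g hg with
  | not ht => exact .not (hV ht)
  | cnot ha ht hat => exact .cnot (hV ha) (hV ht) hat
  | tof ha hb ht hab hat hbt => exact .tof (hV ha) (hV hb) (hV ht) hab hat hbt

/-- The `r`-th ancilla. -/
def ancilla (r : ℕ) : Wire := match r % 6 with
  | 0 => lt (r / 6)
  | 1 => tie (r / 6)
  | 2 => move (r / 6)
  | 3 => count (r / 6)
  | 4 => carry (r / 6)
  | _ => work (r / 6)

section Layout

variable (M F : ℕ)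

/-- The wire stored in the `q`-th qubit. -/
def wireAt (q : ℕ) : Wire :=
  if q < F * lsbBits M F then reg (q / lsbBits M F) (q % lsbBits M F)
  else if q < succinctLength M F then slot (q - F * lsbBits M F)
  else ancilla (q - succinctLength M F)

/-- The qubit in which a wire is stored. -/
def qubitOf : Wire → ℕ
  | reg k i => k * lsbBits M F + i
  | slot q => F * lsbBits M F + q
  | lt k => succinctLength M F + (6 * k)
  | tie k => succinctLength M F + (6 * k + 1)
  | move k => succinctLength M F + (6 * k + 2)
  | count k => succinctLength M F + (6 * k + 3)
  | carry k => succinctLength M F + (6 * k + 4)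
  | work k => succinctLength M F + (6 * k + 5)

theorem succinctLength_eq : succinctLength M F = F * lsbBits M F + (F + numBars F) := rfl

theorem qubitOf_ancilla (r : ℕ) : qubitOf M F (ancilla r) = succinctLength M F + r := by
  have h := Nat.div_add_mod r 6
  have h6 := Nat.mod_lt r (show 6 > 0 by norm_num)
  rw [ancilla]
  generalize hs : r % 6 = s at h h6
  interval_cases s <;> simp only [qubitOf] <;> omega

theorem qubitOf_wireAt (q : ℕ) : qubitOf M F (wireAt M F q) = q := by
  rw [wireAt]
  split_ifs with h1 h2
  · rw [qubitOf, Nat.mul_comm, Nat.div_add_mod]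
  · rw [qubitOf]
    omega
  · rw [qubitOf_ancilla]
    omega

theorem wireAt_add (r : ℕ) : wireAt M F (succinctLength M F + r) = ancilla r := by
  have := succinctLength_eq M F
  rw [wireAt, if_neg (by omega), if_neg (by omega), Nat.add_sub_cancel_left]

theorem wireAt_qubitOf {x : Wire} (hx : x ∈ validWires M F) :
    wireAt M F (qubitOf M F x) = x ∧ qubitOf M F x < succinctLength M F + 30 * F := by
  have hlen := succinctLength_eq M F
  cases x with
  | reg k i =>
    obtain ⟨hk, hi⟩ : k < F ∧ i < lsbBits M F := hx
    have h1 : (k + 1) * lsbBits M F ≤ F * lsbBits M F := Nat.mul_le_mul_right _ hk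
    rw [Nat.succ_mul] at h1
    have hw : 0 < lsbBits M F := by omega
    have h2 : (k * lsbBits M F + i) / lsbBits M F = k := by
      rw [Nat.add_comm, Nat.add_mul_div_right _ _ hw, Nat.div_eq_of_lt hi, Nat.zero_add]
    have h3 : (k * lsbBits M F + i) % lsbBits M F = i := by
      rw [Nat.add_comm, Nat.add_mul_mod_self_right, Nat.mod_eq_of_lt hi]
    rw [qubitOf, wireAt, if_pos (by omega), h2, h3]
    exact ⟨rfl, by omega⟩
  | slot q =>
    have hq : q < F + numBars F := hx
    rw [qubitOf, wireAt, if_neg (by omega), if_pos (by omega), Nat.add_sub_cancel_left]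
    exact ⟨rfl, by omega⟩
  | _ k =>
    have hk : k < 5 * F := hx
    rw [qubitOf, wireAt_add, ancilla]
    refine ⟨?_, by omega⟩
    simp [Nat.add_mod, Nat.add_div]

/-- The wires of the qubits of the data structure. -/
def layout (q : Fin (succinctLength M F + 30 * F)) : Wire := wireAt M F q

theorem layout_injective : Function.Injective (layout M F) := fun q q' h => by
  have := congrArg (qubitOf M F) h
  rw [layout, layout, qubitOf_wireAt, qubitOf_wireAt] at this
  exact Fin.ext this

theorem validWires_subset_range : validWires M F ⊆ Set.range (layout M F) := fun _ hx =>
  ⟨⟨_, (wireAt_qubitOf M F hx).2⟩, (wireAt_qubitOf M F hx).1⟩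

variable {M F}

theorem memory_comp_layout (b : Fin M → Bool) :
    memory F b (fun _ => false) false ∘ layout M F =
      Fin.append (succinctEncoding F b) fun _ => false := by
  funext q
  refine Fin.addCases (fun q => ?_) (fun r => ?_) q
  · rw [Fin.append_left, Function.comp_apply, layout, succinctEncoding, wireAt, Fin.val_castAdd]
    by_cases h : q.val < F * lsbBits M F
    · have hw : 0 < lsbBits M F := Nat.pos_of_ne_zero fun h0 => by simp [h0] at h
      have h1 : q.val / lsbBits M F < F := (Nat.div_lt_iff_lt_mul hw).2 h
      rw [if_pos h, succinctList_getD_of_lt b h, memory, decide_eq_true ⟨h1, Nat.mod_lt _ hw⟩,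
        Bool.true_and]
    · obtain ⟨r, hr⟩ := Nat.exists_eq_add_of_le (not_lt.1 h)
      rw [if_neg h, if_pos q.isLt, hr, succinctList_getD_add, Nat.add_sub_cancel_left, memory]
  · rw [Fin.append_right, Function.comp_apply, layout, Fin.val_natAdd, wireAt_add, ancilla]
    split <;> simp [memory]

end Layout

/-! ### Constructing data structures -/

theorem ket_injective {n : ℕ} : Function.Injective (ket (n := n)) := fun x y h => by
  by_contra hxy
  have h1 : ket x x = ket y x := by rw [h]
  rw [ket_apply, ket_apply, if_pos rfl, if_neg hxy] at h1
  exact one_ne_zero h1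

section Construction

variable {M F n : ℕ}

/-- The linear map sending the Fock states to the given computational basis states. -/
def encodeMap (e : Occupation M 0 F → Fin n → Bool) : FockSpace M 0 F →ₗ[ℂ] QubitSpace n :=
  (EuclideanSpace.basisFun (Occupation M 0 F) ℂ).toBasis.constr ℂ fun b => ket (e b)

theorem encodeMap_fockState (e : Occupation M 0 F → Fin n → Bool) (b : Occupation M 0 F) :
    encodeMap e (fockState b) = ket (e b) := by
  have h := (EuclideanSpace.basisFun (Occupation M 0 F) ℂ).toBasis.constr_basis ℂ
    (fun b => ket (e b)) b
  rwa [OrthonormalBasis.coe_toBasis, EuclideanSpace.basisFun_apply] at h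

theorem encodeMap_injective {e : Occupation M 0 F → Fin n → Bool} (he : Function.Injective e) :
    Function.Injective (encodeMap e) := by
  have hli : LinearIndependent ℂ fun b => (ket (e b) : QubitSpace n) := by
    have h := (EuclideanSpace.basisFun (Fin n → Bool) ℂ).toBasis.linearIndependent.comp e he
    have hcomp : (fun b => (ket (e b) : QubitSpace n)) =
        (EuclideanSpace.basisFun (Fin n → Bool) ℂ).toBasis ∘ e := by
      funext b
      simp [ket]
    rwa [hcomp]
  exact Module.Basis.injective_constr_of_linearIndependent _ hli

/-- A data structure from circuits acting on computational basis states. -/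
def ofBasisStates (e : Occupation M 0 F → Fin n → Bool) (he : Function.Injective e)
    (flip rank : Fin M → Circuit n)
    (hflip : ∀ (j : Fin M) (b : Occupation M 0 F)
      (h : 0 ≤ hammingWeight (bitFlip j b.1) ∧ hammingWeight (bitFlip j b.1) ≤ F),
      Circuit.apply (flip j) (ket (e b)) = ket (e ⟨bitFlip j b.1, h⟩))
    (hrank : ∀ (j : Fin M) (b : Occupation M 0 F),
      Circuit.apply (rank j) (ket (e b)) = (sgnRank j b.1 : ℂ) • ket (e b)) :
    FermionDataStructure M 0 F n where
  encode := encodeMap e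
  encode_injective := encodeMap_injective he
  encode_fockState b := ⟨e b, encodeMap_fockState e b⟩
  flipCircuit := flip
  rankCircuit := rank
  flip_spec j b h := by rw [encodeMap_fockState, encodeMap_fockState, hflip j b h]
  rank_spec j b := by rw [encodeMap_fockState, hrank]

end Construction

/-! ### Bounds -/

/-- This is (M/F)^F ≤ binom(M,F), which holds factor by factor since (M - i)/(F - i) ≥ M/F for i <
F. -/
theorem pow_le_pow_mul_choose {M F : ℕ} (h : F ≤ M) : M ^ F ≤ F ^ F * M.choose F := by
  have h1 : F.factorial * M ^ F ≤ F ^ F * M.descFactorial F := by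
    have hpow (a : ℕ) : a ^ F = ∏ _i ∈ Finset.range F, a := by simp
    rw [← Nat.descFactorial_self, Nat.descFactorial_eq_prod_range, Nat.descFactorial_eq_prod_range,
      hpow M, hpow F, ← Finset.prod_mul_distrib, ← Finset.prod_mul_distrib]
    refine Finset.prod_le_prod' fun i _ => ?_
    rw [Nat.sub_mul, Nat.mul_sub]
    exact Nat.sub_le_sub_left (by rw [Nat.mul_comm]; exact Nat.mul_le_mul_left i h) _
  rw [Nat.descFactorial_eq_factorial_mul_choose, Nat.mul_left_comm] at h1
  exact Nat.le_of_mul_le_mul_left h1 (Nat.factorial_pos F)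

theorem two_pow_pointerBits_le {M : ℕ} (hM : 0 < M) : 2 ^ pointerBits M ≤ 2 * M := by
  have h1 := Nat.pow_pred_clog_lt_self Nat.one_lt_two (x := M + 1) (by omega)
  have h2 := Nat.clog_pos Nat.one_lt_two (n := M + 1) (by omega)
  rw [pointerBits]
  obtain ⟨m, hm⟩ : ∃ m, Nat.clog 2 (M + 1) = m + 1 := ⟨Nat.clog 2 (M + 1) - 1, by omega⟩
  rw [hm] at h1 ⊢
  rw [pow_succ]
  simp only [Nat.pred_eq_sub_one, Nat.add_sub_cancel] at h1
  omega

/-- After multiplication by 2^(GF), the claim follows from 2^(LF) ≤ (2M)^F ≤ 2^F F^F binom(M,F). The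
rounding in L costs the summand F, and rounding F up to 2^G is harmless because that factor cancels.
-/
theorem mul_lsbBits_le {M F : ℕ} (hF : F < M) :
    F * lsbBits M F ≤ infoBound M F + F := by
  have h1 : F ≤ 2 ^ msbBits F := Nat.le_pow_clog Nat.one_lt_two F
  have h2 : M.choose F ≤ 2 ^ infoBound M F := Nat.le_pow_clog Nat.one_lt_two _
  have h3 := two_pow_pointerBits_le (M := M) (by omega)
  have h4 := two_pow_msbBits_mul hF
  have h5 : (2 ^ msbBits F) ^ F * 2 ^ (F * lsbBits M F) ≤
      (2 ^ msbBits F) ^ F * 2 ^ (infoBound M F + F) := by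
    calc (2 ^ msbBits F) ^ F * 2 ^ (F * lsbBits M F) = (2 ^ pointerBits M) ^ F := by
          rw [← h4, mul_pow, ← pow_mul 2 (lsbBits M F), Nat.mul_comm (lsbBits M F)]
      _ ≤ (2 * M) ^ F := Nat.pow_le_pow_left h3 F
      _ = 2 ^ F * M ^ F := mul_pow ..
      _ ≤ 2 ^ F * (F ^ F * M.choose F) := Nat.mul_le_mul_left _ (pow_le_pow_mul_choose hF.le)
      _ ≤ 2 ^ F * ((2 ^ msbBits F) ^ F * 2 ^ infoBound M F) := by gcongr
      _ = _ := by rw [pow_add]; ring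
  have h6 := Nat.le_of_mul_le_mul_left h5 (by positivity)
  exact (Nat.pow_le_pow_iff_right (by norm_num)).1 h6

theorem succinctLength_add_le {M F : ℕ} (hF0 : 0 < F) (hF : F < M) :
    succinctLength M F + 30 * F ≤ infoBound M F + 34 * F := by
  have h1 := mul_lsbBits_le hF
  have h2 := numBars_le hF0
  rw [succinctLength_eq]
  omega

theorem pointerBits_le_logb {M : ℕ} (hM : 2 ≤ M) : (pointerBits M : ℝ) ≤ 2 * Real.logb 2 M := by
  have hM' : (2 : ℝ) ≤ M := by exact_mod_cast hM
  have h1 : (1 : ℝ) ≤ Real.logb 2 M := by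
    rw [Real.le_logb_iff_rpow_le (by norm_num) (by linarith)]
    simpa using hM'
  have h2 : (pointerBits M : ℝ) ≤ Real.logb 2 (2 * M) := by
    rw [Real.le_logb_iff_rpow_le (by norm_num) (by linarith), Real.rpow_natCast]
    exact_mod_cast two_pow_pointerBits_le (M := M) (by omega)
  rw [Real.logb_mul (by norm_num) (by linarith), Real.logb_self_eq_one (by norm_num)] at h2
  linarith

theorem pointerBits_pos {M : ℕ} (hM : 0 < M) : 0 < pointerBits M :=
  Nat.clog_pos Nat.one_lt_two (by omega)

/-! ### The data structure -/

section Structure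

variable {M F : ℕ}

theorem HasCost.exists_layout_circuit {π : Equiv.Perm (Wire → Bool)} {N : ℕ}
    (h : HasCost (validWires M F) π N) :
    ∃ c : Circuit (succinctLength M F + 30 * F), c.length ≤ 34 * N ∧
      ∀ s : Wire → Bool, Circuit.apply c (ket (s ∘ layout M F)) = ket (π s ∘ layout M F) :=
  (h.mono_set (validWires_subset_range M F)).exists_circuit (layout_injective M F)

theorem work_zero_mem_range (hF0 : 0 < F) : work 0 ∈ Set.range (layout M F) :=
  validWires_subset_range M F (show 0 < 5 * F by omega)

/-- Equal encodings would give equal results under the circuit that reads the bit at j into `work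
0`, for every j. -/
theorem memory_comp_layout_injective (hF0 : 0 < F) (hF : F < M) :
    Function.Injective fun b : Occupation M 0 F =>
      memory F b.1 (fun _ => false) false ∘ layout M F := by
  intro b b' h
  apply Subtype.ext
  funext j
  obtain ⟨c, -, hc⟩ := (hasCost_memberGate hF0 hF j).exists_layout_circuit
  have h1 := hc (memory F b.1 (fun _ => false) false)
  have h2 := hc (memory F b'.1 (fun _ => false) false)
  rw [memberGate_memory hF b.2.2] at h1
  rw [memberGate_memory hF b'.2.2] at h2
  obtain ⟨q, hq⟩ := work_zero_mem_range (M := M) hF0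
  have h3 := congrFun (ket_injective (h1.symm.trans ((congrArg _ (congrArg ket h)).trans h2))) q
  simpa [hq, memory] using h3

/-- The parity of the ones up to j is computed into a clean wire, a sign on that wire turns it into
the phase `sgnRank`, and the inverse circuit clears the wire. -/
theorem exists_rankCircuit (hF0 : 0 < F) (hF : F < M) (j : Fin M) :
    ∃ c : Circuit (succinctLength M F + 30 * F),
      c.length ≤ F * (41824 * pointerBits M) ∧
      ∀ b : Occupation M 0 F,
        Circuit.apply c (ket (memory F b.1 (fun _ => false) false ∘ layout M F)) =
          (sgnRank j b.1 : ℂ) • ket (memory F b.1 (fun _ => false) false ∘ layout M F) := by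
  have hj := succ_le_noFermion j
  have hcost := hasCost_countParity hF0 hF hj
  obtain ⟨c, hc, hcs⟩ := hcost.exists_layout_circuit
  obtain ⟨d, hd, hds⟩ := hcost.inv.exists_layout_circuit
  obtain ⟨q, hq⟩ := work_zero_mem_range (M := M) hF0
  refine ⟨c ++ (zCircuit q ++ d), ?_, fun b => ?_⟩
  -- The constant is 34 · 2 · (264 + 351) + 4, the last 4 being the sign; additive terms are
  -- absorbed by `1 ≤ pointerBits M`.
  · simp only [List.length_append, zCircuit, List.length_replicate]
    have h1 : 1 ≤ pointerBits M := pointerBits_pos (by omega)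
    have h2 : F * 1 ≤ F * pointerBits M := Nat.mul_le_mul_left _ h1
    nlinarith
  · rw [Circuit.apply_append, Circuit.apply_append, hcs, apply_zCircuit, map_smul, hds,
      ← Equiv.Perm.mul_apply, inv_mul_cancel, Equiv.Perm.one_apply,
      countParity_memory hF b.2.2 hj, sgnRank_eq]
    congr 1
    rw [Function.comp_apply, hq]
    simp only [memory, decide_true, Bool.true_and, Bool.false_xor]
    push_cast
    rcases Nat.mod_two_eq_zero_or_one (onesBelow b.1 (j + 1)) with h | h
    · rw [(Nat.even_iff.2 h).neg_one_pow]
      simp [h]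
    · rw [(Nat.odd_iff.2 h).neg_one_pow]
      simp [h]

theorem exists_flipCircuit (hF0 : 0 < F) (hF : F < M) (j : Fin M) :
    ∃ c : Circuit (succinctLength M F + 30 * F),
      c.length ≤ F * (105774 * pointerBits M) ∧
      ∀ b : Fin M → Bool, hammingWeight b ≤ F → hammingWeight (bitFlip j b) ≤ F →
        Circuit.apply c (ket (memory F b (fun _ => false) false ∘ layout M F)) =
          ket (memory F (bitFlip j b) (fun _ => false) false ∘ layout M F) := by
  obtain ⟨c, hc, hcs⟩ := (hasCost_flipGate hF0 hF j).exists_layout_circuit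
  refine ⟨c, ?_, fun b hb hb' => by rw [hcs, flipGate_memory hF j hb hb']⟩
  -- The constant is 34 · (1327 + 1784).
  have h1 : 1 ≤ pointerBits M := pointerBits_pos (by omega)
  have h2 : F * 1 ≤ F * pointerBits M := Nat.mul_le_mul_left _ h1
  nlinarith

theorem exists_dataStructure (hF0 : 0 < F) (hF : F < M) :
    ∃ D : FermionDataStructure M 0 F (succinctLength M F + 30 * F),
      (∀ b : Occupation M 0 F, D.encode (fockState b) =
        ket (Fin.append (succinctEncoding F b.1) (fun _ : Fin (30 * F) => false))) ∧
      D.gateComplexity ≤ F * (105774 * pointerBits M) := by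
  choose rank hrank hrank' using exists_rankCircuit hF0 hF
  choose flip hflip hflip' using exists_flipCircuit hF0 hF
  refine ⟨ofBasisStates _ (memory_comp_layout_injective hF0 hF) flip rank
    (fun j b h => hflip' j b.1 b.2.2 h.2) hrank', fun b => ?_, Finset.sup_le fun j _ => ?_⟩
  · rw [← memory_comp_layout]
    exact encodeMap_fockState _ b
  · exact max_le (hflip j) ((hrank j).trans
      (Nat.mul_le_mul_left _ (Nat.mul_le_mul_right _ (by norm_num))))

theorem eq_false_of_hammingWeight_le_zero {b : Fin M → Bool} (h : hammingWeight b ≤ 0)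
    (j : Fin M) : b j = false := by
  rw [Nat.le_zero, hammingWeight, Finset.card_eq_zero, Finset.filter_eq_empty_iff] at h
  simpa using h (Finset.mem_univ j)

/-- Only the zero string has weight 0. No flip stays within the capacity and every sign is 1, so
empty circuits suffice. -/
theorem exists_dataStructure_zero :
    ∃ D : FermionDataStructure M 0 0 (succinctLength M 0 + 0),
      (∀ b : Occupation M 0 0, D.encode (fockState b) =
        ket (Fin.append (succinctEncoding 0 b.1) (fun _ : Fin 0 => false))) ∧
      D.gateComplexity ≤ 0 := by
  have he : Function.Injective fun b : Occupation M 0 0 =>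
      Fin.append (succinctEncoding 0 b.1) (fun _ : Fin 0 => false) := fun b b' _ => by
    apply Subtype.ext
    funext j
    rw [eq_false_of_hammingWeight_le_zero b.2.2 j, eq_false_of_hammingWeight_le_zero b'.2.2 j]
  refine ⟨ofBasisStates _ he (fun _ => []) (fun _ => []) (fun j b h => ?_) (fun j b => ?_),
    fun b => encodeMap_fockState _ b, Finset.sup_le fun j _ => le_rfl⟩
  · have h1 := eq_false_of_hammingWeight_le_zero h.2 j
    rw [bitFlip_apply_self, eq_false_of_hammingWeight_le_zero b.2.2 j] at h1
    exact absurd h1 (by simp)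
  · have h1 : sgnRank j b.1 = 1 := by
      rw [sgnRank]
      refine Finset.prod_eq_one fun i _ => ?_
      rw [eq_false_of_hammingWeight_le_zero b.2.2 i]
      rfl
    rw [Circuit.apply_nil, h1, Int.cast_one, one_smul]

end Structure

end FermionEncoding

end

theorem theorem4 :
    ∃ C : ℕ, ∀ M F : ℕ, F < M →
      ∃ (a : ℕ) (D : FermionDataStructure M 0 F (succinctLength M F + a)),
        (∀ b : Occupation M 0 F,
          D.encode (fockState b) =
            ket (Fin.append (succinctEncoding F b.1) (fun _ : Fin a => false))) ∧
        succinctLength M F + a ≤ infoBound M F + C * F ∧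
        (D.gateComplexity : ℝ) ≤ C * (F * Real.logb 2 M) := by
  -- The constant is 2 · 105774, the factor 2 coming from L ≤ 2 log₂ M for M ≥ 2. It also exceeds
  -- the 34 needed for the number of qubits.
  refine ⟨211548, fun M F hF => ?_⟩
  rcases Nat.eq_zero_or_pos F with rfl | hF0
  · obtain ⟨D, hD, hg⟩ := exists_dataStructure_zero (M := M)
    refine ⟨0, D, hD, ?_, ?_⟩
    · simp [succinctLength, msbBits]
    · simp [Nat.le_zero.1 hg]
  · obtain ⟨D, hD, hg⟩ := exists_dataStructure hF0 hF
    refine ⟨30 * F, D, hD, (succinctLength_add_le hF0 hF).trans (by omega), ?_⟩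
    have h1 : (D.gateComplexity : ℝ) ≤ F * (105774 * pointerBits M) := by exact_mod_cast hg
    have h2 := pointerBits_le_logb (M := M) (by omega)
    calc (D.gateComplexity : ℝ) ≤ F * (105774 * pointerBits M) := h1
      _ ≤ F * (105774 * (2 * Real.logb 2 M)) := by gcongr
      _ = _ := by push_cast; ring
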